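/- Graphs are simple, non-empty, possibly infinite and not necessarily connected. A graph $G$ is viewed as a metric graph: every edge is identified with the interval $[0,1]$, the points of $G$ are its vertices and the points of its edges, and $d_G$ is the shortest-path distance between points ($\infty$ between different components). A geodesic triangle $T$ in $G$ is the union of three geodesics $[x_1x_2]$, $[x_2x_3]$, $[x_3x_1]$ joining three points $x_1,x_2,x_3$ of $G$; it is $\delta$-thin if every point of each of these three sides is at distance at most $\delta$ from the union of the other two; $\delta(T)$ is the infimum of the $\delta\ge 0$ such that $T$ is $\delta$-thin, and the hyperbolicity constant is $\delta(G)=\sup\{\delta(T): T \text{ a geodesic triangle in } G\}\in[0,\infty]$. The graph join $G_1\uplus G_2$ is obtained from the disjoint union of $G_1$ and $G_2$ by adding all edges between a vertex of $G_1$ and a vertex of $G_2$. Let $C_n$ be the cycle with vertices $v_1,\dots,v_n$ in cyclic order. Let - $\mathcal C_6^{(1)}$ be the set of graphs obtained from $C_6$ by adding a (possibly empty, possibly full) subset of $\{[v_2,v_6],[v_4,v_6]\}$; - $\mathcal C_7^{(1)}$ be the set of graphs obtained from $C_7$ by adding a subset of $\{[v_2,v_6],[v_2,v_7],[v_4,v_6],[v_4,v_7]\}$;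 - $\mathcal C_8^{(1)}$ be the set of graphs obtained from $C_8$ by adding a subset of $\{[v_2,v_6],[v_2,v_8],[v_4,v_6],[v_4,v_8]\}$; - $\mathcal C_8^{(2)}$ be the set of graphs obtained from $C_8$ by adding a subset of $\{[v_2,v_8],[v_4,v_6],[v_4,v_7],[v_4,v_8]\}$; - $\mathcal C_9^{(1)}$ be the set of graphs obtained from $C_9$ by adding a subset of $\{[v_2,v_6],[v_2,v_9],[v_4,v_6],[v_4,v_9]\}$. For $n\in\{6,7,9\}$ let $\mathcal F_n$ be the class of graphs containing, as an induced subgraph, a graph isomorphic to an element of $\mathcal C_n^{(1)}$; let $\mathcal F_8$ be the class of graphs containing, as an induced subgraph, a graph isomorphic to an element of $\mathcal C_8^{(1)}\cup\mathcal C_8^{(2)}$. Put $\mathcal F=\mathcal F_6\cup\mathcal F_7\cup\mathcal F_8\cup\mathcal F_9$. **Theorem.** Let $G_1,G_2$ be any two graphs. Then $\delta(G_1\uplus G_2)=3/2$ if and only if $G_1\in\mathcal F$ or $G_2\in\mathcal F$. -/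

import Mathlib

open scoped ENNReal

universe u v

namespace GraphHyp

section Hyperbolicity

/-- `S` is the image of a geodesic `γ : [0, L] → X` from `x` to `y`, i.e. of a curve with
`d (γ s) (γ t) = |s - t|` for all `s, t ∈ [0, L]`. -/
def IsGeodesicSegment {X : Type u} [PseudoEMetricSpace X] (x y : X) (S : Set X) : Prop :=
  ∃ (L : ℝ) (γ : ℝ → X), 0 ≤ L ∧ γ 0 = x ∧ γ L = y ∧
    (∀ s ∈ Set.Icc 0 L, ∀ t ∈ Set.Icc 0 L, edist (γ s) (γ t) = ENNReal.ofReal |s - t|) ∧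
    S = γ '' Set.Icc 0 L

/-- A geodesic triangle: three points (in cyclic order) and a geodesic joining each of them to
the next one. -/
structure GeodesicTriangle (X : Type u) [PseudoEMetricSpace X] where
  vertex : Fin 3 → X
  side : Fin 3 → Set X
  geodesic : ∀ i, IsGeodesicSegment (vertex i) (vertex (i + 1)) (side i)

/-- Every point of each side is at distance at most `δ` from the union of the other two sides. -/
def GeodesicTriangle.IsThin {X : Type u} [PseudoEMetricSpace X] (T : GeodesicTriangle X)
    (δ : ℝ≥0∞) : Prop :=
  ∀ i, ∀ p ∈ T.side i, Metric.infEDist p (⋃ (j : Fin 3) (_ : j ≠ i), T.side j) ≤ δ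

/-- The sharp thin constant `δ(T)` of a geodesic triangle. -/
noncomputable def GeodesicTriangle.thinConstant {X : Type u} [PseudoEMetricSpace X]
    (T : GeodesicTriangle X) : ℝ≥0∞ :=
  sInf {δ : ℝ≥0∞ | T.IsThin δ}

/-- The sharp hyperbolicity constant `δ(X)`: the supremum of `δ(T)` over all geodesic triangles.
Points joined by a geodesic are at finite distance, so every triangle lies in one component,
and this is the supremum of the constants of the components. -/
noncomputable def hyperbolicityConstant (X : Type u) [PseudoEMetricSpace X] : ℝ≥0∞ :=
  ⨆ T : GeodesicTriangle X, T.thinConstant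

end Hyperbolicity

section MetricGraph

/-- The closed unit edge with endpoints `a` and `b`, in barycentric coordinates (the vertex `a`
is the basis vector `single a 1`). -/
def edgeSegment {V : Type u} (a b : V) : Set (V →₀ ℝ) :=
  segment ℝ (Finsupp.single a 1) (Finsupp.single b 1)

/-- The points of the graph `G`: the vertices (`a = b`) and the points of the edges, each edge
being a copy of the interval `[0, 1]`. -/
@[ext]
structure MetricGraph {V : Type u} (G : SimpleGraph V) where
  coord : V →₀ ℝ
  mem_edge : ∃ a b, (a = b ∨ G.Adj a b) ∧ coord ∈ edgeSegment a b

namespace MetricGraph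

variable {V : Type u} {G : SimpleGraph V}

/-- The length of the sub-interval between `x` and `y` of an edge that contains both of them
(and `⊤` if there is no such edge). -/
noncomputable def distAlongEdge (x y : MetricGraph G) : ℝ≥0∞ :=
  ⨅ (a : V) (b : V) (_ : G.Adj a b) (_ : x.coord ∈ edgeSegment a b)
    (_ : y.coord ∈ edgeSegment a b), ENNReal.ofReal |x.coord a - y.coord a|

/-- The length of a shortest path from `x` to `y` that goes from `x` along its edge to an
endpoint `a`, then from `a` to `b` in the graph, and then from `b` along the edge of `y` to `y`.
If `x.coord a ≠ 0` then `x` lies at distance `1 - x.coord a` from `a` on an edge at `a`. -/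
noncomputable def distThroughVertices (x y : MetricGraph G) : ℝ≥0∞ :=
  ⨅ (a : V) (b : V) (_ : x.coord a ≠ 0) (_ : y.coord b ≠ 0),
    ENNReal.ofReal (1 - x.coord a) + (G.edist a b : ℝ≥0∞) + ENNReal.ofReal (1 - y.coord b)

lemma mem_edgeSegment_iff {a b : V} (hab : a ≠ b) {x : V →₀ ℝ} :
    x ∈ edgeSegment a b ↔
      0 ≤ x a ∧ 0 ≤ x b ∧ x a + x b = 1 ∧ ∀ c, c ≠ a → c ≠ b → x c = 0 := by
  classical
  constructor
  · rintro ⟨s, t, hs, ht, hst, rfl⟩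
    refine ⟨?_, ?_, ?_, ?_⟩
    · simpa [Finsupp.single_apply, hab.symm] using hs
    · simpa [Finsupp.single_apply, hab] using ht
    · simpa [Finsupp.single_apply, hab, hab.symm] using hst
    · intro c h1 h2
      simp [h1.symm, h2.symm]
  · rintro ⟨h1, h2, h3, h4⟩
    refine ⟨x a, x b, h1, h2, h3, ?_⟩
    ext c
    by_cases hca : c = a
    · subst hca; simp [hab.symm]
    · by_cases hcb : c = b
      · subst hcb; simp [hab]
      · simp [Ne.symm hca, Ne.symm hcb, h4 c hca hcb]

lemma edgeSegment_self (a : V) : edgeSegment a a = {Finsupp.single a (1 : ℝ)} :=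
  segment_same ℝ _

/-- Two different vertices with nonzero coordinate are adjacent, and their coordinates add up
to `1`. -/
lemma adj_of_coord_ne_zero (x : MetricGraph G) {a b : V} (hab : a ≠ b) (ha : x.coord a ≠ 0)
    (hb : x.coord b ≠ 0) : G.Adj a b ∧ x.coord a + x.coord b = 1 := by
  classical
  obtain ⟨c, d, hcd, hx⟩ := x.mem_edge
  rcases hcd with rfl | hcd
  · rw [edgeSegment_self, Set.mem_singleton_iff] at hx
    rw [hx, Finsupp.single_apply] at ha hb
    exact absurd ((by simpa using ha : c = a).symm.trans (by simpa using hb)) hab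
  · obtain ⟨-, -, h3, h4⟩ := (mem_edgeSegment_iff hcd.ne).1 hx
    have ha' : a = c ∨ a = d := by by_contra! h; exact ha (h4 a h.1 h.2)
    have hb' : b = c ∨ b = d := by by_contra! h; exact hb (h4 b h.1 h.2)
    rcases ha' with rfl | rfl <;> rcases hb' with rfl | rfl
    · exact absurd rfl hab
    · exact ⟨hcd, h3⟩
    · exact ⟨hcd.symm, by linarith⟩
    · exact absurd rfl hab

lemma coord_nonneg (x : MetricGraph G) (a : V) : 0 ≤ x.coord a := by
  classical
  obtain ⟨c, d, -, s, t, hs, ht, -, h⟩ := x.mem_edge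
  rw [← h]
  simp only [Finsupp.add_apply, Finsupp.smul_apply, Finsupp.single_apply, smul_eq_mul]
  split_ifs <;> simp <;> linarith

lemma coord_le_one (x : MetricGraph G) (a : V) : x.coord a ≤ 1 := by
  classical
  obtain ⟨c, d, -, s, t, hs, ht, hst, h⟩ := x.mem_edge
  rw [← h]
  simp only [Finsupp.add_apply, Finsupp.smul_apply, Finsupp.single_apply, smul_eq_mul]
  split_ifs <;> simp <;> linarith

lemma exists_coord_ne_zero (x : MetricGraph G) : ∃ a, x.coord a ≠ 0 := by
  classical
  obtain ⟨c, d, hcd, hx⟩ := x.mem_edge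
  rcases hcd with rfl | hcd
  · rw [edgeSegment_self, Set.mem_singleton_iff] at hx
    exact ⟨c, by simp [hx]⟩
  · obtain ⟨-, -, h3, -⟩ := (mem_edgeSegment_iff hcd.ne).1 hx
    by_contra! h
    rw [h c, h d] at h3
    norm_num at h3

lemma distAlongEdge_comm (x y : MetricGraph G) : distAlongEdge x y = distAlongEdge y x := by
  have key : ∀ x y : MetricGraph G, distAlongEdge x y ≤ distAlongEdge y x := by
    intro x y
    refine le_iInf fun a => le_iInf fun b => le_iInf fun h => le_iInf fun hy => le_iInf fun hx => ?_
    rw [abs_sub_comm]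
    exact iInf_le_of_le a (iInf_le_of_le b (iInf_le_of_le h (iInf_le_of_le hx
      (iInf_le_of_le hy le_rfl))))
  exact le_antisymm (key x y) (key y x)

lemma distThroughVertices_comm (x y : MetricGraph G) :
    distThroughVertices x y = distThroughVertices y x := by
  have key : ∀ x y : MetricGraph G, distThroughVertices x y ≤ distThroughVertices y x := by
    intro x y
    refine le_iInf fun b => le_iInf fun a => le_iInf fun hb => le_iInf fun ha => ?_
    refine iInf_le_of_le a (iInf_le_of_le b (iInf_le_of_le ha (iInf_le_of_le hb ?_)))
    rw [SimpleGraph.edist_comm, add_comm, add_comm (ENNReal.ofReal (1 - x.coord a)), ← add_assoc]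
  exact le_antisymm (key x y) (key y x)

/-- Moving along an edge from `x` to `y` and on to a vertex `b` of the carrier of `y` is no
shorter than moving directly from `x` to `b`. -/
lemma along_to_vertex {x y : MetricGraph G} {a a' b : V} (h : G.Adj a a')
    (hx : x.coord ∈ edgeSegment a a') (hy : y.coord ∈ edgeSegment a a') (hb : y.coord b ≠ 0) :
    ∃ c, x.coord c ≠ 0 ∧ ENNReal.ofReal (1 - x.coord c) + (G.edist c b : ℝ≥0∞) ≤
      ENNReal.ofReal |x.coord a - y.coord a| + ENNReal.ofReal (1 - y.coord b) := by
  have main : ∀ a a' : V, G.Adj a a' → x.coord ∈ edgeSegment a a' → y.coord ∈ edgeSegment a a' →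
      ∃ c, x.coord c ≠ 0 ∧ ENNReal.ofReal (1 - x.coord c) + (G.edist c a : ℝ≥0∞) ≤
      ENNReal.ofReal |x.coord a - y.coord a| + ENNReal.ofReal (1 - y.coord a) := by
    intro a a' h hx hy
    obtain ⟨hx1, hx2, hx3, hx4⟩ := (mem_edgeSegment_iff h.ne).1 hx
    have hya := coord_le_one y a
    by_cases hxa : x.coord a = 0
    · refine ⟨a', by intro h0; rw [hxa, h0] at hx3; norm_num at hx3, ?_⟩
      rw [SimpleGraph.edist_eq_one_iff_adj.2 h.symm, ← ENNReal.ofReal_add (abs_nonneg _) (by linarith)]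
      have : x.coord a' = 1 := by linarith
      rw [this]
      simp only [sub_self, ENNReal.ofReal_zero, zero_add, ENat.toENNReal_one]
      rw [← ENNReal.ofReal_one]
      apply ENNReal.ofReal_le_ofReal
      have := neg_abs_le (x.coord a - y.coord a)
      linarith
    · refine ⟨a, hxa, ?_⟩
      rw [SimpleGraph.edist_self, ← ENNReal.ofReal_add (abs_nonneg _) (by linarith)]
      simp only [ENat.toENNReal_zero, add_zero]
      apply ENNReal.ofReal_le_ofReal
      have := neg_abs_le (x.coord a - y.coord a)
      linarith
  have hx' := (mem_edgeSegment_iff h.ne).1 hx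
  have hy' := (mem_edgeSegment_iff h.ne).1 hy
  have hb' : b = a ∨ b = a' := by by_contra! h; exact hb (hy'.2.2.2 b h.1 h.2)
  rcases hb' with rfl | rfl
  · exact main _ _ h hx hy
  · have hs : |x.coord a - y.coord a| = |x.coord b - y.coord b| := by
      rw [abs_sub_comm (x.coord b)]
      congr 1
      linarith [hx'.2.2.1, hy'.2.2.1]
    rw [hs]
    have hsymm : edgeSegment a b = edgeSegment b a := segment_symm ℝ _ _
    rw [hsymm] at hx hy
    exact main _ _ h.symm hx hy

lemma distThroughVertices_le {x y : MetricGraph G} {a b : V} (ha : x.coord a ≠ 0)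
    (hb : y.coord b ≠ 0) : distThroughVertices x y ≤
    ENNReal.ofReal (1 - x.coord a) + (G.edist a b : ℝ≥0∞) + ENNReal.ofReal (1 - y.coord b) :=
  iInf_le_of_le a (iInf_le_of_le b (iInf_le_of_le ha (iInf_le_of_le hb le_rfl)))

lemma distAlongEdge_le {x y : MetricGraph G} {a b : V} (h : G.Adj a b)
    (hx : x.coord ∈ edgeSegment a b) (hy : y.coord ∈ edgeSegment a b) :
    distAlongEdge x y ≤ ENNReal.ofReal |x.coord a - y.coord a| :=
  iInf_le_of_le a (iInf_le_of_le b (iInf_le_of_le h (iInf_le_of_le hx (iInf_le_of_le hy le_rfl))))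

lemma edist_toENNReal_triangle (a b c : V) :
    (G.edist a c : ℝ≥0∞) ≤ (G.edist a b : ℝ≥0∞) + (G.edist b c : ℝ≥0∞) := by
  rw [← ENat.toENNReal_add]
  exact ENat.toENNReal_le.2 SimpleGraph.edist_triangle

/-- The distance between two points of the metric graph `G` (`⊤` if they lie in different
connected components). -/
noncomputable def pointDist (x y : MetricGraph G) : ℝ≥0∞ :=
  min (distAlongEdge x y) (distThroughVertices x y)

lemma pointDist_comm (x y : MetricGraph G) : pointDist x y = pointDist y x := by
  rw [pointDist, pointDist, distAlongEdge_comm, distThroughVertices_comm]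

lemma pointDist_self (x : MetricGraph G) : pointDist x x = 0 := by
  classical
  rw [← nonpos_iff_eq_zero]
  obtain ⟨a, b, hab, hx⟩ := x.mem_edge
  rcases hab with rfl | hab
  · rw [edgeSegment_self, Set.mem_singleton_iff] at hx
    have h1 : x.coord a = 1 := by simp [hx]
    have h0 : x.coord a ≠ 0 := by rw [h1]; norm_num
    refine (min_le_right _ _).trans ((distThroughVertices_le h0 h0).trans ?_)
    simp [h1]
  · refine (min_le_left _ _).trans ((distAlongEdge_le hab hx hx).trans ?_)
    simp

lemma le_along_add {x y : MetricGraph G} {D e : ℝ≥0∞}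
    (h : ∀ a b, G.Adj a b → x.coord ∈ edgeSegment a b → y.coord ∈ edgeSegment a b →
      D ≤ ENNReal.ofReal |x.coord a - y.coord a| + e) : D ≤ distAlongEdge x y + e := by
  unfold distAlongEdge
  simp only [ENNReal.iInf_add, le_iInf_iff]
  exact h

lemma le_through_add {x y : MetricGraph G} {D e : ℝ≥0∞}
    (h : ∀ a b, x.coord a ≠ 0 → y.coord b ≠ 0 →
      D ≤ ENNReal.ofReal (1 - x.coord a) + (G.edist a b : ℝ≥0∞) +
        ENNReal.ofReal (1 - y.coord b) + e) : D ≤ distThroughVertices x y + e := by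
  unfold distThroughVertices
  simp only [ENNReal.iInf_add, le_iInf_iff]
  exact h

lemma through_through (x y z : MetricGraph G) :
    pointDist x z ≤ distThroughVertices x y + distThroughVertices y z := by
  refine (min_le_right _ _).trans ?_
  refine le_through_add fun a b ha hb => ?_
  rw [add_comm]
  refine le_through_add fun b' c hb' hc => ?_
  refine (distThroughVertices_le ha hc).trans ?_
  have key : (G.edist b b' : ℝ≥0∞) ≤
      ENNReal.ofReal (1 - y.coord b) + ENNReal.ofReal (1 - y.coord b') := by
    by_cases hbb : b = b'
    · subst hbb; simp
    · obtain ⟨hadj, hsum⟩ := adj_of_coord_ne_zero y hbb hb hb'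
      rw [SimpleGraph.edist_eq_one_iff_adj.2 hadj,
        ← ENNReal.ofReal_add (by linarith [coord_le_one y b]) (by linarith [coord_le_one y b']),
        ENat.toENNReal_one, ← ENNReal.ofReal_one]
      exact ENNReal.ofReal_le_ofReal (by linarith)
  have h1 : (G.edist a c : ℝ≥0∞) ≤ (G.edist a b : ℝ≥0∞) +
      ((ENNReal.ofReal (1 - y.coord b) + ENNReal.ofReal (1 - y.coord b')) +
        (G.edist b' c : ℝ≥0∞)) :=
    (edist_toENNReal_triangle a b c).trans
      (add_le_add le_rfl ((edist_toENNReal_triangle b b' c).trans (add_le_add key le_rfl)))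
  calc _ ≤ ENNReal.ofReal (1 - x.coord a) + ((G.edist a b : ℝ≥0∞) +
      ((ENNReal.ofReal (1 - y.coord b) + ENNReal.ofReal (1 - y.coord b')) +
        (G.edist b' c : ℝ≥0∞))) + ENNReal.ofReal (1 - z.coord c) := by gcongr
    _ = _ := by ring

lemma along_through (x y z : MetricGraph G) :
    pointDist x z ≤ distAlongEdge x y + distThroughVertices y z := by
  refine (min_le_right _ _).trans ?_
  refine le_along_add fun a a' h hx hy => ?_
  rw [add_comm]
  refine le_through_add fun b d hb hd => ?_
  obtain ⟨c, hc, hle⟩ := along_to_vertex h hx hy hb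
  refine (distThroughVertices_le hc hd).trans ?_
  calc _ ≤ ENNReal.ofReal (1 - x.coord c) + ((G.edist c b : ℝ≥0∞) + (G.edist b d : ℝ≥0∞)) +
        ENNReal.ofReal (1 - z.coord d) := by gcongr; exact edist_toENNReal_triangle c b d
    _ = (ENNReal.ofReal (1 - x.coord c) + (G.edist c b : ℝ≥0∞)) + (G.edist b d : ℝ≥0∞) +
        ENNReal.ofReal (1 - z.coord d) := by ring
    _ ≤ (ENNReal.ofReal |x.coord a - y.coord a| + ENNReal.ofReal (1 - y.coord b)) +
        (G.edist b d : ℝ≥0∞) + ENNReal.ofReal (1 - z.coord d) := by gcongr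
    _ = _ := by ring

lemma along_along (x y z : MetricGraph G) :
    pointDist x z ≤ distAlongEdge x y + distAlongEdge y z := by
  refine le_along_add fun a b hab hx hy => ?_
  rw [add_comm, distAlongEdge_comm]
  refine le_along_add fun c d hcd hz hy' => ?_
  by_cases hab0 : y.coord a ≠ 0 ∧ y.coord b ≠ 0
  · refine (min_le_left _ _).trans ?_
    obtain ⟨-, -, hs, h0⟩ := (mem_edgeSegment_iff hcd.ne).1 hy'
    obtain ⟨-, -, hzs, -⟩ := (mem_edgeSegment_iff hcd.ne).1 hz
    have ha : a = c ∨ a = d := by by_contra! h; exact hab0.1 (h0 a h.1 h.2)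
    have hb : b = c ∨ b = d := by by_contra! h; exact hab0.2 (h0 b h.1 h.2)
    have hz' : z.coord ∈ edgeSegment a b ∧ |z.coord c - y.coord c| = |z.coord a - y.coord a| := by
      rcases ha with rfl | rfl <;> rcases hb with rfl | rfl
      · exact absurd rfl hab.ne
      · exact ⟨hz, rfl⟩
      · refine ⟨(segment_symm ℝ _ _).subset hz, ?_⟩
        rw [abs_sub_comm (z.coord a)]
        congr 1
        linarith
      · exact absurd rfl hab.ne
    refine (distAlongEdge_le hab hx hz'.1).trans ?_
    rw [hz'.2, ← ENNReal.ofReal_add (abs_nonneg _) (abs_nonneg _)]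
    apply ENNReal.ofReal_le_ofReal
    rw [add_comm, abs_sub_comm (z.coord a)]
    exact abs_sub_le _ _ _
  · obtain ⟨-, -, hs, -⟩ := (mem_edgeSegment_iff hab.ne).1 hy
    have : ∃ e, y.coord e = 1 := by
      by_cases h : y.coord a = 0
      · exact ⟨b, by linarith⟩
      · exact ⟨a, by have : y.coord b = 0 := by tauto
                     linarith⟩
    obtain ⟨e, he⟩ := this
    have he0 : y.coord e ≠ 0 := by rw [he]; norm_num
    obtain ⟨p, hp, hple⟩ := along_to_vertex hab hx hy he0
    obtain ⟨q, hq, hqle⟩ := along_to_vertex hcd hz hy' he0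
    simp only [he, sub_self, ENNReal.ofReal_zero, add_zero] at hple hqle
    refine (min_le_right _ _).trans ((distThroughVertices_le hp hq).trans ?_)
    calc _ ≤ ENNReal.ofReal (1 - x.coord p) + ((G.edist p e : ℝ≥0∞) + (G.edist e q : ℝ≥0∞)) +
          ENNReal.ofReal (1 - z.coord q) := by gcongr; exact edist_toENNReal_triangle p e q
      _ = (ENNReal.ofReal (1 - z.coord q) + (G.edist q e : ℝ≥0∞)) +
          (ENNReal.ofReal (1 - x.coord p) + (G.edist p e : ℝ≥0∞)) := by
        rw [SimpleGraph.edist_comm (u := e)]; ring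
      _ ≤ _ := add_le_add hqle hple

lemma pointDist_triangle (x y z : MetricGraph G) :
    pointDist x z ≤ pointDist x y + pointDist y z := by
  rcases min_choice (distAlongEdge x y) (distThroughVertices x y) with h1 | h1 <;>
    rcases min_choice (distAlongEdge y z) (distThroughVertices y z) with h2 | h2
  · rw [pointDist.eq_1 x y, pointDist.eq_1 y z, h1, h2]; exact along_along x y z
  · rw [pointDist.eq_1 x y, pointDist.eq_1 y z, h1, h2]; exact along_through x y z
  · rw [pointDist.eq_1 x y, pointDist.eq_1 y z, h1, h2, pointDist_comm, add_comm,
      distAlongEdge_comm, distThroughVertices_comm]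
    exact along_through z y x
  · rw [pointDist.eq_1 x y, pointDist.eq_1 y z, h1, h2]; exact through_through x y z

noncomputable instance : PseudoEMetricSpace (MetricGraph G) where
  edist := pointDist
  edist_self := pointDist_self
  edist_comm := pointDist_comm
  edist_triangle := pointDist_triangle

end MetricGraph

/-- The hyperbolicity constant `δ(G)` of a graph. -/
noncomputable def graphHyperbolicityConstant {V : Type u} (G : SimpleGraph V) : ℝ≥0∞ :=
  hyperbolicityConstant (MetricGraph G)

end MetricGraph

/-- The graph join: the disjoint union of the two graphs together with all edges between the
first one and the second one. -/
def graphJoin {V : Type u} {W : Type v} (G : SimpleGraph V) (H : SimpleGraph W) :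
    SimpleGraph (V ⊕ W) :=
  (G ⊕g H) ⊔ completeBipartiteGraph V W

section Families

/-- The graphs obtained from the cycle `C_n` by adding a (proper or not) subset of the set of
edges `E`. -/
def cycleWithChords (n : ℕ) (E : Set (Sym2 (Fin n))) : Set (SimpleGraph (Fin n)) :=
  {H | ∃ S ⊆ E, H = SimpleGraph.cycleGraph n ⊔ SimpleGraph.fromEdgeSet S}

/-! The vertices of `C_n` are numbered `0, …, n - 1` here, so `i : Fin n` is the vertex usually
called `v_{i+1}`. -/

def C6 : Set (SimpleGraph (Fin 6)) := cycleWithChords 6 {s(1, 5), s(3, 5)}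

def C7 : Set (SimpleGraph (Fin 7)) := cycleWithChords 7 {s(1, 5), s(1, 6), s(3, 5), s(3, 6)}

def C8₁ : Set (SimpleGraph (Fin 8)) := cycleWithChords 8 {s(1, 5), s(1, 7), s(3, 5), s(3, 7)}

def C8₂ : Set (SimpleGraph (Fin 8)) := cycleWithChords 8 {s(1, 7), s(3, 5), s(3, 6), s(3, 7)}

def C9 : Set (SimpleGraph (Fin 9)) := cycleWithChords 9 {s(1, 5), s(1, 8), s(3, 5), s(3, 8)}

/-- The graphs on `V` that contain, as an induced subgraph, an isomorphic copy of some element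
of `𝒞`. -/
def containingInduced {n : ℕ} (V : Type u) (𝒞 : Set (SimpleGraph (Fin n))) :
    Set (SimpleGraph V) :=
  {G | ∃ H ∈ 𝒞, H.IsIndContained G}

def F6 (V : Type u) : Set (SimpleGraph V) := containingInduced V C6

def F7 (V : Type u) : Set (SimpleGraph V) := containingInduced V C7

def F8 (V : Type u) : Set (SimpleGraph V) := containingInduced V (C8₁ ∪ C8₂)

def F9 (V : Type u) : Set (SimpleGraph V) := containingInduced V C9

/-- The family `𝓕 = 𝓕₆ ∪ 𝓕₇ ∪ 𝓕₈ ∪ 𝓕₉`. -/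
def familyF (V : Type u) : Set (SimpleGraph V) := F6 V ∪ F7 V ∪ F8 V ∪ F9 V

end Families

end GraphHyp

/-! The vertices of a join are at distance at most 2, so its points are at distance at most 3. A
point on a side of length at most 3 is within 3/2 of an end of that side, and this end lies on
another side. Hence `hyperbolicityConstant_le` gives the bound 3/2, and the question is when it is
reached.

In the extremal picture one side has length 3 and runs m(a'a), a, w, b, m(bb'), where m is the
midpoint of an edge and no vertex of {a, a'} equals or is adjacent to a vertex of {b, b'}. The other
two sides (the wings) must stay at distance at least 3/2 from w, so they leave through a' and b' and
then visit only vertices not adjacent to w. As a wing has length at most 3, it has at most two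
vertices after a' or b'. Together with a', a, w, b, b' the wings close up to a cycle of 6 to 9
vertices with w = v₃, whose only possible chords join a = v₂ or b = v₄ to vertices of the wings.
That the wings are geodesics restricts these chords further. The wing lengths are 3/2, 3/2 for C₆;
2, 2 for C₇; 5/2, 5/2 for the first C₈; 3, 2 for the second; 3, 3 for C₉.

Conversely each listed graph yields such a triangle: distances within the join are determined by
adjacency alone, and `three_halves_le_of_farGeodesic` evaluates the triangle at w.

The supremum is not assumed to be attained. A triangle with constant above 59/40 has the ends of its
long side within 1/20 of midpoints, and the combinatorics is that of the extremal case
(`exists_center_of_isometricOn`). Unwanted chords between wing vertices are shortcuts that lead to a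
smaller cycle (`Core.inducedFamily_two` to `Core.inducedFamily_five`).

Finally, non-adjacent vertices of a join lie in the same factor. The wing vertices, a' and b' are
not adjacent to w, a is not adjacent to b', and b is not adjacent to a', so the whole cycle lies in
the factor of w. -/

namespace GraphHyp

/-! ### Coordinates and distances of points in a graph of diameter at most two. -/

namespace MetricGraph

variable {V : Type u} {G : SimpleGraph V}

/-- A vertex of the graph, as a point of the metric graph. -/
noncomputable def ofVertex (G : SimpleGraph V) (a : V) : MetricGraph G where
  coord := Finsupp.single a 1
  mem_edge := ⟨a, a, Or.inl rfl, by rw [edgeSegment_self]; rfl⟩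

@[simp] lemma ofVertex_coord_self (a : V) : (ofVertex G a).coord a = 1 := by
  simp [ofVertex]

lemma ofVertex_coord_ne_zero {a b : V} (h : (ofVertex G a).coord b ≠ 0) : b = a := by
  classical
  by_contra hab
  exact h (by simp [ofVertex, Ne.symm hab])

lemma eq_ofVertex_of_coord_eq_one {x : MetricGraph G} {a : V} (h : x.coord a = 1) :
    x = ofVertex G a := by
  classical
  ext c
  by_cases hc : c = a
  · subst hc; simp [h]
  · have : x.coord c = 0 := by
      by_contra h0
      have h2 := (adj_of_coord_ne_zero x hc h0 (by rw [h]; norm_num)).2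
      exact h0 (by linarith)
    rw [this]
    simp [ofVertex, Ne.symm hc]

lemma mem_edgeSegment_of_coord {x : MetricGraph G} {a b : V} (hab : a ≠ b)
    (h : x.coord a + x.coord b = 1) : x.coord ∈ edgeSegment a b := by
  classical
  refine (mem_edgeSegment_iff hab).2 ⟨coord_nonneg x a, coord_nonneg x b, h, fun c hca hcb => ?_⟩
  obtain ⟨p, q, hpq, hx⟩ := x.mem_edge
  rcases hpq with rfl | hpq
  · rw [edgeSegment_self, Set.mem_singleton_iff] at hx
    rw [hx] at h ⊢
    simp only [Finsupp.single_apply] at h ⊢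
    split_ifs at h ⊢ <;> simp_all
  · obtain ⟨-, -, h3, h4⟩ := (mem_edgeSegment_iff hpq.ne).1 hx
    by_contra hc
    have hc' : c = p ∨ c = q := by by_contra! h'; exact hc (h4 c h'.1 h'.2)
    have ha' : a = p ∨ a = q ∨ x.coord a = 0 := by
      by_contra! h'; exact h'.2.2 (h4 a h'.1 h'.2.1)
    have hb' : b = p ∨ b = q ∨ x.coord b = 0 := by
      by_contra! h'; exact h'.2.2 (h4 b h'.1 h'.2.1)
    rcases hc' with rfl | rfl <;> rcases ha' with rfl | rfl | ha' <;>
      rcases hb' with rfl | rfl | hb' <;>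
      first
      | exact absurd rfl hab
      | exact absurd rfl hca
      | exact absurd rfl hcb
      | exact hc (by linarith)

lemma exists_adj_of_coord_lt_one {x : MetricGraph G} {a : V} (h0 : x.coord a ≠ 0)
    (h1 : x.coord a < 1) : ∃ b, G.Adj a b ∧ x.coord a + x.coord b = 1 := by
  classical
  obtain ⟨c, d, hcd, hx⟩ := x.mem_edge
  rcases hcd with rfl | hcd
  · rw [edgeSegment_self, Set.mem_singleton_iff] at hx
    rw [hx, Finsupp.single_apply] at h0 h1
    split_ifs at h0 h1
    · exact absurd h1 (lt_irrefl _)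
    · exact absurd rfl h0
  · obtain ⟨-, -, h3, h4⟩ := (mem_edgeSegment_iff hcd.ne).1 hx
    have ha' : a = c ∨ a = d := by by_contra! h; exact h0 (h4 a h.1 h.2)
    rcases ha' with rfl | rfl
    · exact ⟨d, hcd, h3⟩
    · exact ⟨c, hcd.symm, by linarith⟩

/-- A point has at most two vertices in its carrier. -/
lemma eq_or_eq_of_coord_ne_zero {x : MetricGraph G} {a b c : V} (hab : a ≠ b)
    (h : x.coord a + x.coord b = 1) (hc : x.coord c ≠ 0) : c = a ∨ c = b := by
  by_contra! hne
  exact hc (((mem_edgeSegment_iff hab).1 (mem_edgeSegment_of_coord hab h)).2.2.2 c hne.1 hne.2)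

/-- Along an edge both end coordinates change at the same rate and the others vanish. In particular
the length along an edge does not depend on the choice of the common edge. -/
lemma abs_coord_sub_le {x y : V →₀ ℝ} {a b : V} (hab : a ≠ b) (hx : x ∈ edgeSegment a b)
    (hy : y ∈ edgeSegment a b) (c : V) : |x c - y c| ≤ |x a - y a| := by
  obtain ⟨-, -, h3, h4⟩ := (mem_edgeSegment_iff hab).1 hx
  obtain ⟨-, -, h3', h4'⟩ := (mem_edgeSegment_iff hab).1 hy
  by_cases hca : c = a
  · rw [hca]
  by_cases hcb : c = b
  · rw [abs_sub_comm (x a), hcb]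
    exact le_of_eq (congrArg _ (by linarith))
  · rw [h4 c hca hcb, h4' c hca hcb]
    simp

/-- The real-valued distance of two points (meaningful in a graph of finite diameter). -/
noncomputable def rdist (x y : MetricGraph G) : ℝ := (edist x y).toReal

lemma rdist_comm (x y : MetricGraph G) : rdist x y = rdist y x := by
  rw [rdist, rdist, edist_comm]

lemma rdist_nonneg (x y : MetricGraph G) : 0 ≤ rdist x y := ENNReal.toReal_nonneg

lemma edist_ne_top (hG : ∀ a b, G.edist a b ≤ 2) (x y : MetricGraph G) : edist x y ≠ ⊤ := by
  obtain ⟨a, ha⟩ := exists_coord_ne_zero x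
  obtain ⟨b, hb⟩ := exists_coord_ne_zero y
  refine ne_top_of_le_ne_top ?_ ((min_le_right _ _).trans (distThroughVertices_le ha hb))
  have : (G.edist a b : ℝ≥0∞) ≠ ⊤ := by
    rw [Ne, ENat.toENNReal_eq_top]
    intro h
    have := hG a b
    rw [h] at this
    exact absurd this (by decide)
  finiteness

lemma edist_eq_ofReal (hG : ∀ a b, G.edist a b ≤ 2) (x y : MetricGraph G) :
    edist x y = ENNReal.ofReal (rdist x y) :=
  (ENNReal.ofReal_toReal (edist_ne_top hG x y)).symm

lemma rdist_triangle (hG : ∀ a b, G.edist a b ≤ 2) (x y z : MetricGraph G) :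
    rdist x z ≤ rdist x y + rdist y z := by
  rw [rdist, rdist, rdist, ← ENNReal.toReal_add (edist_ne_top hG x y) (edist_ne_top hG y z)]
  exact ENNReal.toReal_mono (by simp [edist_ne_top hG]) (edist_triangle x y z)

lemma rdist_le_of_edist_le {x y : MetricGraph G} {a b : V} (ha : x.coord a ≠ 0)
    (hb : y.coord b ≠ 0) {n : ℕ} (hn : G.edist a b ≤ n) :
    rdist x y ≤ (1 - x.coord a) + n + (1 - y.coord b) := by
  have h1 := sub_nonneg.2 (coord_le_one x a)
  have h2 := sub_nonneg.2 (coord_le_one y b)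
  refine ENNReal.toReal_le_of_le_ofReal (by positivity) ?_
  refine ((min_le_right _ _).trans (distThroughVertices_le ha hb)).trans ?_
  rw [ENNReal.ofReal_add (by positivity) h2, ENNReal.ofReal_add h1 (by positivity)]
  gcongr
  rw [ENNReal.ofReal_natCast]
  exact_mod_cast ENat.toENNReal_le.2 hn

lemma rdist_le_two_add (hG : ∀ a b, G.edist a b ≤ 2) {x y : MetricGraph G} {a b : V}
    (ha : x.coord a ≠ 0) (hb : y.coord b ≠ 0) :
    rdist x y ≤ (1 - x.coord a) + 2 + (1 - y.coord b) := by
  exact_mod_cast rdist_le_of_edist_le ha hb (n := 2) (by exact_mod_cast hG a b)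

lemma rdist_le_of_adj {x y : MetricGraph G} {a b : V} (ha : x.coord a ≠ 0)
    (hb : y.coord b ≠ 0) (hab : G.Adj a b) :
    rdist x y ≤ (1 - x.coord a) + 1 + (1 - y.coord b) := by
  exact_mod_cast rdist_le_of_edist_le ha hb (n := 1)
    (by exact_mod_cast (SimpleGraph.edist_eq_one_iff_adj.2 hab).le)

lemma rdist_le_of_common {x y : MetricGraph G} {a : V} (ha : x.coord a ≠ 0)
    (hb : y.coord a ≠ 0) : rdist x y ≤ (1 - x.coord a) + (1 - y.coord a) := by
  have := rdist_le_of_edist_le ha hb (n := 0) (by simp)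
  push_cast at this
  linarith

lemma rdist_le_of_mem_edge {x y : MetricGraph G} {a b : V} (hab : G.Adj a b)
    (hx : x.coord ∈ edgeSegment a b) (hy : y.coord ∈ edgeSegment a b) :
    rdist x y ≤ |x.coord a - y.coord a| :=
  ENNReal.toReal_le_of_le_ofReal (abs_nonneg _)
    ((min_le_left _ _).trans (distAlongEdge_le hab hx hy))

lemma distAlongEdge_attained {x y : MetricGraph G} (h : distAlongEdge x y ≠ ⊤) :
    ∃ a b, G.Adj a b ∧ x.coord ∈ edgeSegment a b ∧ y.coord ∈ edgeSegment a b ∧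
      distAlongEdge x y = ENNReal.ofReal |x.coord a - y.coord a| := by
  have : ∃ a b, G.Adj a b ∧ x.coord ∈ edgeSegment a b ∧ y.coord ∈ edgeSegment a b := by
    by_contra! hne
    apply h
    simp only [distAlongEdge, iInf_eq_top]
    exact fun a b hab hx hy => absurd hy (hne a b hab hx)
  obtain ⟨a, b, hab, hx, hy⟩ := this
  refine ⟨a, b, hab, hx, hy, le_antisymm (distAlongEdge_le hab hx hy) ?_⟩
  simp only [distAlongEdge, le_iInf_iff]
  exact fun c d hcd hx' hy' => ENNReal.ofReal_le_ofReal (abs_coord_sub_le hcd.ne hx' hy' a)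

lemma distThroughVertices_attained (x y : MetricGraph G) :
    ∃ a b, x.coord a ≠ 0 ∧ y.coord b ≠ 0 ∧ distThroughVertices x y =
      ENNReal.ofReal (1 - x.coord a) + (G.edist a b : ℝ≥0∞) + ENNReal.ofReal (1 - y.coord b) := by
  obtain ⟨a, ha⟩ := exists_coord_ne_zero x
  obtain ⟨b, hb⟩ := exists_coord_ne_zero y
  -- The infimum ranges over the finitely many vertices carrying the two points, so it is a minimum.
  obtain ⟨⟨c, d⟩, hcd, hmin⟩ := Finset.exists_min_image (x.coord.support ×ˢ y.coord.support)
    (fun p => ENNReal.ofReal (1 - x.coord p.1) + (G.edist p.1 p.2 : ℝ≥0∞) +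
      ENNReal.ofReal (1 - y.coord p.2)) ⟨(a, b), by simp [ha, hb]⟩
  simp only [Finset.mem_product, Finsupp.mem_support_iff] at hcd
  refine ⟨c, d, hcd.1, hcd.2, le_antisymm (distThroughVertices_le hcd.1 hcd.2) ?_⟩
  simp only [distThroughVertices, le_iInf_iff]
  exact fun p q hp hq => hmin (p, q) (by simp [hp, hq])

lemma two_le_edist {a b : V} (hne : a ≠ b) (hab : ¬ G.Adj a b) : 2 ≤ G.edist a b := by
  have h0 : G.edist a b ≠ 0 := fun h => hne (SimpleGraph.edist_eq_zero_iff.1 h)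
  have h1 : G.edist a b ≠ 1 := fun h => hab (SimpleGraph.edist_eq_one_iff_adj.1 h)
  generalize G.edist a b = n at h0 h1
  cases n with
  | top => exact le_top
  | coe n =>
    norm_cast at *
    omega

/-- The shapes of a shortest path between two points: along an edge, or through one, two adjacent
or two non-adjacent vertices. -/
lemma rdist_cases (hG : ∀ a b, G.edist a b ≤ 2) (x y : MetricGraph G) :
    (∃ a b, G.Adj a b ∧ x.coord ∈ edgeSegment a b ∧ y.coord ∈ edgeSegment a b ∧
      rdist x y = |x.coord a - y.coord a|) ∨
    (∃ a, x.coord a ≠ 0 ∧ y.coord a ≠ 0 ∧ (1 - x.coord a) + (1 - y.coord a) ≤ rdist x y) ∨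
    (∃ a b, G.Adj a b ∧ x.coord a ≠ 0 ∧ y.coord b ≠ 0 ∧
      (1 - x.coord a) + 1 + (1 - y.coord b) ≤ rdist x y) ∨
    (∃ a b, a ≠ b ∧ ¬ G.Adj a b ∧ x.coord a ≠ 0 ∧ y.coord b ≠ 0 ∧
      (1 - x.coord a) + 2 + (1 - y.coord b) ≤ rdist x y) := by
  have htop := edist_ne_top hG x y
  have hxy : edist x y = min (distAlongEdge x y) (distThroughVertices x y) := rfl
  rcases min_choice (distAlongEdge x y) (distThroughVertices x y) with h | h
  · left
    rw [h] at hxy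
    obtain ⟨a, b, hab, hx, hy, heq⟩ := distAlongEdge_attained (hxy ▸ htop)
    exact ⟨a, b, hab, hx, hy, by rw [rdist, hxy, heq, ENNReal.toReal_ofReal (abs_nonneg _)]⟩
  · right
    rw [h] at hxy
    obtain ⟨a, b, ha, hb, heq⟩ := distThroughVertices_attained x y
    have h1 := sub_nonneg.2 (coord_le_one x a)
    have h2 := sub_nonneg.2 (coord_le_one y b)
    have key : ∀ n : ℕ, n ≤ G.edist a b → (1 - x.coord a) + n + (1 - y.coord b) ≤ rdist x y := by
      intro n hn
      rw [rdist, ← ENNReal.ofReal_le_iff_le_toReal htop, hxy, heq,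
        ENNReal.ofReal_add (by positivity) h2, ENNReal.ofReal_add h1 (by positivity)]
      gcongr
      rw [ENNReal.ofReal_natCast]
      exact_mod_cast ENat.toENNReal_le.2 hn
    by_cases hab : a = b
    · subst hab
      left
      have := key 0 (by simp)
      push_cast at this
      exact ⟨a, ha, hb, by linarith⟩
    · right
      by_cases hadj : G.Adj a b
      · left
        exact ⟨a, b, hadj, ha, hb, by
          exact_mod_cast key 1 (by exact_mod_cast (SimpleGraph.edist_eq_one_iff_adj.2 hadj).ge)⟩
      · right
        exact ⟨a, b, hab, hadj, ha, hb, by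
          exact_mod_cast key 2 (by exact_mod_cast two_le_edist hab hadj)⟩

/-- The shapes of a shortest path from a point to a vertex. -/
lemma rdist_ofVertex_cases (hG : ∀ a b, G.edist a b ≤ 2) (x : MetricGraph G) (e : V) :
    (x.coord e ≠ 0 ∧ rdist x (ofVertex G e) = 1 - x.coord e) ∨
    (x.coord e = 0 ∧ ∃ a, G.Adj a e ∧ x.coord a ≠ 0 ∧
      (1 - x.coord a) + 1 ≤ rdist x (ofVertex G e)) ∨
    (x.coord e = 0 ∧ ∃ a, a ≠ e ∧ ¬ G.Adj a e ∧ x.coord a ≠ 0 ∧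
      (1 - x.coord a) + 2 ≤ rdist x (ofVertex G e)) := by
  have hee : (ofVertex G e).coord e = 1 := ofVertex_coord_self e
  by_cases hxe : x.coord e = 0
  · right
    rcases rdist_cases hG x (ofVertex G e) with ⟨a, b, hab, hx, hy, h⟩ | ⟨a, ha, hb, h⟩ |
      ⟨a, b, hab, ha, hb, h⟩ | ⟨a, b, hne, hab, ha, hb, h⟩
    · obtain ⟨-, -, hx3, -⟩ := (mem_edgeSegment_iff hab.ne).1 hx
      obtain ⟨-, -, hy3, hy4⟩ := (mem_edgeSegment_iff hab.ne).1 hy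
      have he : e = a ∨ e = b := by
        by_contra! h'
        have := hy4 e h'.1 h'.2
        rw [hee] at this
        norm_num at this
      left
      refine ⟨hxe, ?_⟩
      rcases he with rfl | rfl
      · refine ⟨b, hab.symm, by intro h0; rw [hxe, h0] at hx3; norm_num at hx3, ?_⟩
        rw [h, hxe, hee]
        norm_num
        linarith
      · have ha : x.coord a = 1 := by linarith
        refine ⟨a, hab, by rw [ha]; norm_num, ?_⟩
        rw [h, ha, show (ofVertex G e).coord a = 0 by linarith]
        norm_num
    · exact absurd hxe (ofVertex_coord_ne_zero hb ▸ ha)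
    · obtain rfl := ofVertex_coord_ne_zero hb
      exact Or.inl ⟨hxe, a, hab, ha, by linarith⟩
    · obtain rfl := ofVertex_coord_ne_zero hb
      exact Or.inr ⟨hxe, a, hne, hab, ha, by linarith⟩
  · left
    refine ⟨hxe, le_antisymm ?_ ?_⟩
    · have := rdist_le_of_common (x := x) (y := ofVertex G e) hxe (by rw [hee]; norm_num)
      linarith
    · rcases rdist_cases hG x (ofVertex G e) with ⟨a, b, hab, hx, hy, h⟩ | ⟨a, ha, hb, h⟩ |
        ⟨a, b, hab, ha, hb, h⟩ | ⟨a, b, hne, hab, ha, hb, h⟩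
      · have h1 := abs_coord_sub_le hab.ne hx hy e
        rw [← h, hee, abs_sub_comm] at h1
        exact (le_abs_self _).trans h1
      · obtain rfl := ofVertex_coord_ne_zero hb
        linarith
      all_goals
        have h1 := coord_le_one x a
        have h2 := coord_nonneg x e
        obtain rfl := ofVertex_coord_ne_zero hb
        linarith

lemma exists_half_le_coord (x : MetricGraph G) : ∃ a, 1 / 2 ≤ x.coord a := by
  obtain ⟨a, ha⟩ := exists_coord_ne_zero x
  by_cases h : x.coord a = 1
  · exact ⟨a, by linarith⟩
  · obtain ⟨b, -, hb⟩ := exists_adj_of_coord_lt_one ha (lt_of_le_of_ne (coord_le_one x a) h)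
    by_cases h2 : 1 / 2 ≤ x.coord a
    · exact ⟨a, h2⟩
    · exact ⟨b, by linarith⟩

/-- In a graph of diameter two, the points are at distance at most three. -/
lemma rdist_le_three (hG : ∀ a b, G.edist a b ≤ 2) (x y : MetricGraph G) : rdist x y ≤ 3 := by
  obtain ⟨a, ha⟩ := exists_half_le_coord x
  obtain ⟨b, hb⟩ := exists_half_le_coord y
  have := rdist_le_two_add hG (x := x) (y := y) (a := a) (b := b) (by linarith) (by linarith)
  linarith

end MetricGraph
end GraphHyp

/-! ### Concatenation of geodesics. -/

namespace GraphHyp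

namespace IsGeodesicSegment

variable {X : Type u} [PseudoEMetricSpace X] {x y z : X} {S S' : Set X}

lemma symm (h : IsGeodesicSegment x y S) : IsGeodesicSegment y x S := by
  obtain ⟨L, γ, hL, h0, h1, hγ, rfl⟩ := h
  refine ⟨L, fun t => γ (L - t), hL, by simpa using h1, by simpa using h0, ?_, ?_⟩
  · intro s hs t ht
    rw [hγ _ ⟨by linarith [hs.2], by linarith [hs.1]⟩ _ ⟨by linarith [ht.2], by linarith [ht.1]⟩,
      abs_sub_comm]
    congr 2
    ring
  · ext q
    constructor
    · rintro ⟨t, ht, rfl⟩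
      exact ⟨L - t, ⟨by linarith [ht.2], by linarith [ht.1]⟩, by simp⟩
    · rintro ⟨t, ht, rfl⟩
      exact ⟨L - t, ⟨by linarith [ht.2], by linarith [ht.1]⟩, rfl⟩

lemma left_mem (h : IsGeodesicSegment x y S) : x ∈ S := by
  obtain ⟨L, γ, hL, h0, h1, hγ, rfl⟩ := h
  exact ⟨0, ⟨le_rfl, hL⟩, h0⟩

lemma right_mem (h : IsGeodesicSegment x y S) : y ∈ S := h.symm.left_mem

/-- Two geodesics form a geodesic if their lengths add up to the distance of their endpoints. -/
lemma trans (h : IsGeodesicSegment x y S) (h' : IsGeodesicSegment y z S')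
    (hd : edist x y + edist y z ≤ edist x z) : IsGeodesicSegment x z (S ∪ S') := by
  obtain ⟨L, γ, hL, h0, h1, hγ, rfl⟩ := h
  obtain ⟨L', γ', hL', h0', h1', hγ', rfl⟩ := h'
  have hxy : edist x y = ENNReal.ofReal L := by
    rw [← h0, ← h1, hγ 0 ⟨le_rfl, hL⟩ L ⟨hL, le_rfl⟩, zero_sub, abs_neg, abs_of_nonneg hL]
  have hyz : edist y z = ENNReal.ofReal L' := by
    rw [← h0', ← h1', hγ' 0 ⟨le_rfl, hL'⟩ L' ⟨hL', le_rfl⟩, zero_sub, abs_neg, abs_of_nonneg hL']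
  rw [hxy, hyz, ← ENNReal.ofReal_add hL hL'] at hd
  have hmix : ∀ s ∈ Set.Icc 0 L, ∀ t ∈ Set.Icc 0 L',
      edist (γ s) (γ' t) = ENNReal.ofReal (L - s + t) := by
    intro s hs t ht
    apply le_antisymm
    · refine (edist_triangle _ y _).trans ?_
      rw [ENNReal.ofReal_add (by linarith [hs.2]) ht.1, ← h1, hγ s hs L ⟨hL, le_rfl⟩, h1, ← h0',
        hγ' 0 ⟨le_rfl, hL'⟩ t ht, abs_sub_comm, abs_of_nonneg (by linarith [hs.2]), zero_sub,
        abs_neg, abs_of_nonneg ht.1]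
    -- A shorter connection between the two pieces would shorten the path from `x` to `z` below `L +
    -- L'`.
    · have h2 : ENNReal.ofReal (L + L') ≤
          ENNReal.ofReal s + edist (γ s) (γ' t) + ENNReal.ofReal (L' - t) := by
        refine hd.trans ((edist_triangle4 x (γ s) (γ' t) z).trans_eq ?_)
        rw [← h0, hγ 0 ⟨le_rfl, hL⟩ s hs, ← h1', hγ' t ht L' ⟨hL', le_rfl⟩, zero_sub, abs_neg,
          abs_of_nonneg hs.1, abs_sub_comm t, abs_of_nonneg (by linarith [ht.2])]
      have h3 : ENNReal.ofReal (L + L') =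
          ENNReal.ofReal s + ENNReal.ofReal (L - s + t) + ENNReal.ofReal (L' - t) := by
        rw [← ENNReal.ofReal_add hs.1 (by linarith [hs.2, ht.1]),
          ← ENNReal.ofReal_add (by linarith [hs.2, ht.1]) (by linarith [ht.2])]
        congr 1
        ring
      rw [h3] at h2
      exact (ENNReal.add_le_add_iff_left ENNReal.ofReal_ne_top).1
        ((ENNReal.add_le_add_iff_right ENNReal.ofReal_ne_top).1 h2)
  have hjoin : γ L = γ' 0 := by rw [h1, h0']
  refine ⟨L + L', fun t => if t ≤ L then γ t else γ' (t - L), by linarith, by simp [hL, h0], ?_, ?_,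
    ?_⟩
  · by_cases hz : L' = 0
    · simp [hz, hjoin, ← h1']
    · have : 0 < L' := lt_of_le_of_ne hL' (Ne.symm hz)
      simp [this, h1']
  · have key : ∀ s ∈ Set.Icc 0 (L + L'), ∀ t ∈ Set.Icc 0 (L + L'), s ≤ t →
        edist (if s ≤ L then γ s else γ' (s - L)) (if t ≤ L then γ t else γ' (t - L)) =
          ENNReal.ofReal |s - t| := by
      intro s hs t ht hst
      by_cases h2 : t ≤ L
      · rw [if_pos h2, if_pos (hst.trans h2)]
        exact hγ s ⟨hs.1, hst.trans h2⟩ t ⟨ht.1, h2⟩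
      · rw [if_neg h2]
        push Not at h2
        by_cases h3 : s ≤ L
        · rw [if_pos h3, hmix s ⟨hs.1, h3⟩ (t - L) ⟨by linarith, by linarith [ht.2]⟩, abs_sub_comm,
            abs_of_nonneg (by linarith)]
          congr 1
          ring
        · rw [if_neg h3]
          push Not at h3
          rw [hγ' (s - L) ⟨by linarith, by linarith [hs.2]⟩ (t - L)
            ⟨by linarith, by linarith [ht.2]⟩]
          congr 2
          ring
    intro s hs t ht
    rcases le_total s t with h | h
    · exact key s hs t ht h
    · rw [edist_comm, abs_sub_comm]
      exact key t ht s hs h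
  · ext q
    constructor
    · rintro (⟨t, ht, rfl⟩ | ⟨t, ht, rfl⟩)
      · exact ⟨t, ⟨ht.1, by linarith [ht.2]⟩, by simp [ht.2]⟩
      · refine ⟨t + L, ⟨by linarith [ht.1], by linarith [ht.2]⟩, ?_⟩
        by_cases h : t = 0
        · simp [h, hjoin]
        · have : 0 < t := lt_of_le_of_ne ht.1 (Ne.symm h)
          simp [this]
    · rintro ⟨t, ht, rfl⟩
      by_cases h : t ≤ L
      · exact Or.inl ⟨t, ⟨ht.1, h⟩, by simp [h]⟩
      · exact Or.inr ⟨t - L, ⟨by linarith, by linarith [ht.2]⟩, by simp [h]⟩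

end IsGeodesicSegment

/-! ### Points of an edge, lower bounds for distances, and the upper bound 3/2. -/

namespace MetricGraph

variable {V : Type u} {G : SimpleGraph V}

/-- Barycentric coordinates are 1-Lipschitz. This gives the lower bound needed to see that edges are
isometrically embedded. -/
lemma abs_coord_sub_le_rdist (hG : ∀ a b, G.edist a b ≤ 2) (x y : MetricGraph G) (c : V) :
    |x.coord c - y.coord c| ≤ rdist x y := by
  have hx := coord_nonneg x c
  have hy := coord_nonneg y c
  have hx' := coord_le_one x c
  have hy' := coord_le_one y c
  rcases rdist_cases hG x y with ⟨a, b, hab, hx, hy, h⟩ | ⟨a, ha, hb, h⟩ |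
    ⟨a, b, hab, ha, hb, h⟩ | ⟨a, b, hne, hab, ha, hb, h⟩
  · exact (abs_coord_sub_le hab.ne hx hy c).trans h.ge
  · by_cases hca : c = a
    · subst hca
      exact abs_sub_le_iff.2 ⟨by linarith, by linarith⟩
    · have h1 : x.coord c ≤ 1 - x.coord a := by
        by_cases h0 : x.coord c = 0
        · rw [h0]; linarith [coord_le_one x a]
        · linarith [(adj_of_coord_ne_zero x hca h0 ha).2]
      have h2 : y.coord c ≤ 1 - y.coord a := by
        by_cases h0 : y.coord c = 0
        · rw [h0]; linarith [coord_le_one y a]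
        · linarith [(adj_of_coord_ne_zero y hca h0 hb).2]
      exact abs_sub_le_iff.2 ⟨by linarith, by linarith⟩
  all_goals
    have h1 := coord_le_one x a
    have h2 := coord_le_one y b
    exact abs_sub_le_iff.2 ⟨by linarith, by linarith⟩

/-- The point at distance `t` from `a` on the edge `a b` (for `t ∈ [0, 1]`). -/
noncomputable def edgePoint {a b : V} (h : G.Adj a b) (t : ℝ) : MetricGraph G where
  -- Clamping `t` to `[0, 1]` gives a total function of `t`, suitable as a curve.
  coord := (1 - max 0 (min t 1)) • Finsupp.single a 1 + max 0 (min t 1) • Finsupp.single b 1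
  mem_edge := ⟨a, b, Or.inr h, 1 - max 0 (min t 1), max 0 (min t 1), by simp, by simp, by simp, rfl⟩

section EdgePoint

variable {a b : V} (h : G.Adj a b) {s t : ℝ}

lemma edgePoint_coord_right (ht : t ∈ Set.Icc (0 : ℝ) 1) : (edgePoint h t).coord b = t := by
  simp [edgePoint, h.ne, ht.1, ht.2]

lemma edgePoint_coord_left (ht : t ∈ Set.Icc (0 : ℝ) 1) : (edgePoint h t).coord a = 1 - t := by
  simp [edgePoint, h.ne', ht.1, ht.2]

lemma edgePoint_mem (t : ℝ) : (edgePoint h t).coord ∈ edgeSegment a b :=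
  ⟨1 - max 0 (min t 1), max 0 (min t 1), by simp, by simp, by simp, rfl⟩

lemma eq_or_eq_of_edgePoint_coord_ne_zero {c : V} (hc : (edgePoint h t).coord c ≠ 0) :
    c = a ∨ c = b := by
  by_contra! h'
  exact hc (((mem_edgeSegment_iff h.ne).1 (edgePoint_mem h t)).2.2.2 c h'.1 h'.2)

lemma edgePoint_zero : edgePoint h 0 = ofVertex G a :=
  eq_ofVertex_of_coord_eq_one (by rw [edgePoint_coord_left h (by simp)]; simp)

lemma edgePoint_one : edgePoint h 1 = ofVertex G b :=
  eq_ofVertex_of_coord_eq_one (by rw [edgePoint_coord_right h (by simp)])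

lemma edgePoint_symm (ht : t ∈ Set.Icc (0 : ℝ) 1) : edgePoint h.symm (1 - t) = edgePoint h t := by
  ext c
  simp only [edgePoint, min_eq_left ht.2, max_eq_right ht.1,
    min_eq_left (show 1 - t ≤ 1 by linarith [ht.1]), max_eq_right (sub_nonneg.2 ht.2)]
  rw [add_comm]
  simp

lemma rdist_edgePoint (hG : ∀ a b, G.edist a b ≤ 2) (hs : s ∈ Set.Icc (0 : ℝ) 1)
    (ht : t ∈ Set.Icc (0 : ℝ) 1) : rdist (edgePoint h s) (edgePoint h t) = |s - t| := by
  have h1 := rdist_le_of_mem_edge h (edgePoint_mem h s) (edgePoint_mem h t)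
  have h2 := abs_coord_sub_le_rdist hG (edgePoint h s) (edgePoint h t) b
  rw [edgePoint_coord_left h hs, edgePoint_coord_left h ht, abs_sub_comm] at h1
  rw [edgePoint_coord_right h hs, edgePoint_coord_right h ht] at h2
  refine le_antisymm (h1.trans (le_of_eq ?_)) h2
  congr 1
  ring

lemma isGeodesicSegment_edgePoint (hG : ∀ a b, G.edist a b ≤ 2) (hs : 0 ≤ s) (hst : s ≤ t)
    (ht : t ≤ 1) :
    IsGeodesicSegment (edgePoint h s) (edgePoint h t) (edgePoint h '' Set.Icc s t) := by
  refine ⟨t - s, fun r => edgePoint h (s + r), by linarith, by simp, by simp, ?_, ?_⟩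
  · intro p hp q hq
    rw [edist_eq_ofReal hG, rdist_edgePoint h hG ⟨by linarith [hp.1], by linarith [hp.2]⟩
      ⟨by linarith [hq.1], by linarith [hq.2]⟩]
    congr 2
    ring
  · ext q
    constructor
    · rintro ⟨r, hr, rfl⟩
      exact ⟨r - s, ⟨by linarith [hr.1], by linarith [hr.2]⟩, by simp⟩
    · rintro ⟨r, hr, rfl⟩
      exact ⟨s + r, ⟨by linarith [hr.1], by linarith [hr.2]⟩, rfl⟩

end EdgePoint

lemma coord_ne_zero_or_of_mem {x : MetricGraph G} {a b : V} (hab : a ≠ b)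
    (hx : x.coord ∈ edgeSegment a b) : x.coord a ≠ 0 ∨ x.coord b ≠ 0 := by
  by_contra! h
  have := ((mem_edgeSegment_iff hab).1 hx).2.2.1
  rw [h.1, h.2] at this
  norm_num at this

/-- If no vertex carries both points, a path leaves the edge of `x` at cost at least `α`, crosses at
least one full edge, and enters the edge of `y` at cost at least `β`. With no adjacent carriers, as
in `le_rdist_of_not_adj`, it crosses two. -/
lemma le_rdist_of_disjoint (hG : ∀ a b, G.edist a b ≤ 2) {x y : MetricGraph G} {α β : ℝ}
    (hx : ∀ c, x.coord c ≠ 0 → α ≤ 1 - x.coord c) (hy : ∀ c, y.coord c ≠ 0 → β ≤ 1 - y.coord c)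
    (hxy : ∀ c d, x.coord c ≠ 0 → y.coord d ≠ 0 → c ≠ d) : α + 1 + β ≤ rdist x y := by
  rcases rdist_cases hG x y with ⟨a, b, hab, hxe, hye, h⟩ | ⟨a, ha, hb, h⟩ |
    ⟨a, b, hab, ha, hb, h⟩ | ⟨a, b, hne, hab, ha, hb, h⟩
  · have h1 := ((mem_edgeSegment_iff hab.ne).1 hxe).2.2.1
    have h2 := ((mem_edgeSegment_iff hab.ne).1 hye).2.2.1
    by_cases ha : x.coord a = 0
    · have hb : x.coord b ≠ 0 := by rw [ha] at h1; intro h0; rw [h0] at h1; norm_num at h1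
      have hb' : y.coord b = 0 := by by_contra h0; exact hxy b b hb h0 rfl
      have := hx b hb
      have := hy a (by rw [hb'] at h2; intro h0; rw [h0] at h2; norm_num at h2)
      rw [h]
      refine le_trans ?_ (neg_le_abs _)
      linarith
    · have ha' : y.coord a = 0 := by by_contra h0; exact hxy a a ha h0 rfl
      have hb' : y.coord b ≠ 0 := by rw [ha'] at h2; intro h0; rw [h0] at h2; norm_num at h2
      have hb : x.coord b = 0 := by by_contra h0; exact hxy b b h0 hb' rfl
      have := hx a ha
      have := hy b hb'
      rw [h]
      refine le_trans ?_ (le_abs_self _)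
      linarith
  · exact absurd rfl (hxy a a ha hb)
  · linarith [hx a ha, hy b hb]
  · linarith [hx a ha, hy b hb]

lemma le_rdist_of_not_adj (hG : ∀ a b, G.edist a b ≤ 2) {x y : MetricGraph G} {α β : ℝ}
    (hx : ∀ c, x.coord c ≠ 0 → α ≤ 1 - x.coord c) (hy : ∀ c, y.coord c ≠ 0 → β ≤ 1 - y.coord c)
    (hxy : ∀ c d, x.coord c ≠ 0 → y.coord d ≠ 0 → c ≠ d ∧ ¬ G.Adj c d) : α + 2 + β ≤ rdist x y := by
  rcases rdist_cases hG x y with ⟨a, b, hab, hxe, hye, h⟩ | ⟨a, ha, hb, h⟩ |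
    ⟨a, b, hab, ha, hb, h⟩ | ⟨a, b, hne, hab, ha, hb, h⟩
  · rcases coord_ne_zero_or_of_mem hab.ne hxe with h1 | h1 <;>
      rcases coord_ne_zero_or_of_mem hab.ne hye with h2 | h2
    · exact absurd rfl (hxy a a h1 h2).1
    · exact absurd hab (hxy a b h1 h2).2
    · exact absurd hab.symm (hxy b a h1 h2).2
    · exact absurd rfl (hxy b b h1 h2).1
  · exact absurd rfl (hxy a a ha hb).1
  · exact absurd hab (hxy a b ha hb).2
  · linarith [hx a ha, hy b hb]

/-! ### The upper bound -/

lemma hyperbolicityConstant_le (hG : ∀ a b, G.edist a b ≤ 2) :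
    graphHyperbolicityConstant G ≤ 3 / 2 := by
  refine iSup_le fun T => sInf_le ?_
  intro i p hp
  have h32 : (3 / 2 : ℝ≥0∞) = ENNReal.ofReal (3 / 2) := by
    rw [ENNReal.ofReal_div_of_pos (by norm_num)]
    norm_num
  -- Both ends of a side belong to the union of the other two sides, so the nearer end is within
  -- half of the length.
  have hx : T.vertex i ∈ ⋃ (j : Fin 3) (_ : j ≠ i), T.side j := by
    have h1 := (T.geodesic (i + 2)).right_mem
    rw [show i + 2 + 1 = i by omega] at h1
    exact Set.mem_iUnion₂.2 ⟨i + 2, by omega, h1⟩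
  have hy : T.vertex (i + 1) ∈ ⋃ (j : Fin 3) (_ : j ≠ i), T.side j :=
    Set.mem_iUnion₂.2 ⟨i + 1, by omega, (T.geodesic (i + 1)).left_mem⟩
  obtain ⟨L, γ, hL, h0, h1, hγ, hS⟩ := T.geodesic i
  rw [hS] at hp
  obtain ⟨t, ht, rfl⟩ := hp
  have hL3 : L ≤ 3 := by
    have h2 := hγ 0 ⟨le_rfl, hL⟩ L ⟨hL, le_rfl⟩
    have h3 := rdist_le_three hG (γ 0) (γ L)
    rwa [rdist, h2, zero_sub, abs_neg, abs_of_nonneg hL, ENNReal.toReal_ofReal hL] at h3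
  rcases le_total t (3 / 2) with h | h
  · refine (Metric.infEDist_le_edist_of_mem hx).trans ?_
    rw [← h0, hγ t ht 0 ⟨le_rfl, hL⟩, sub_zero, abs_of_nonneg ht.1, h32]
    exact ENNReal.ofReal_le_ofReal h
  · refine (Metric.infEDist_le_edist_of_mem hy).trans ?_
    rw [← h1, hγ t ht L ⟨hL, le_rfl⟩, abs_sub_comm, abs_of_nonneg (by linarith [ht.2]), h32]
    exact ENNReal.ofReal_le_ofReal (by linarith)

/-! ### Geodesics that avoid a neighbourhood of a vertex -/

/-- There is a geodesic from `x` to `y` all of whose points are at distance at least `3 / 2` from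
the vertex `w`. -/
def FarGeodesic (w : V) (x y : MetricGraph G) : Prop :=
  ∃ S, IsGeodesicSegment x y S ∧ ∀ q ∈ S, 3 / 2 ≤ rdist q (ofVertex G w)

lemma FarGeodesic.symm {w : V} {x y : MetricGraph G} (h : FarGeodesic w x y) :
    FarGeodesic w y x := h.imp fun _ h => ⟨h.1.symm, h.2⟩

lemma isGeodesicSegment_trans (hG : ∀ a b, G.edist a b ≤ 2) {x y z : MetricGraph G}
    {S S' : Set (MetricGraph G)} (h : IsGeodesicSegment x y S) (h' : IsGeodesicSegment y z S')
    (hd : rdist x y + rdist y z ≤ rdist x z) : IsGeodesicSegment x z (S ∪ S') := by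
  refine h.trans h' ?_
  rw [edist_eq_ofReal hG, edist_eq_ofReal hG, edist_eq_ofReal hG,
    ← ENNReal.ofReal_add (rdist_nonneg _ _) (rdist_nonneg _ _)]
  exact ENNReal.ofReal_le_ofReal hd

lemma FarGeodesic.trans (hG : ∀ a b, G.edist a b ≤ 2) {w : V} {x y z : MetricGraph G}
    (h : FarGeodesic w x y) (h' : FarGeodesic w y z)
    (hd : rdist x y + rdist y z ≤ rdist x z) : FarGeodesic w x z := by
  obtain ⟨S, hS, hf⟩ := h
  obtain ⟨S', hS', hf'⟩ := h'
  exact ⟨S ∪ S', isGeodesicSegment_trans hG hS hS' hd, fun q hq => hq.elim (hf q) (hf' q)⟩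

/-- From a point of the edge, `w` is reached through `b` at cost `(1 - r) + 1`, which is at least
3/2 for `r ≤ 1 / 2`, or through a vertex not adjacent to `w` at cost at least 2. -/
lemma farGeodesic_edgePoint (hG : ∀ a b, G.edist a b ≤ 2) {a b w : V} (h : G.Adj a b)
    (haw : a ≠ w) (haw' : ¬ G.Adj a w) (hbw : b ≠ w) {s t : ℝ} (hs : 0 ≤ s) (hst : s ≤ t)
    (ht : t ≤ 1) (htw : t ≤ 1 / 2 ∨ ¬ G.Adj b w) :
    FarGeodesic w (edgePoint h s) (edgePoint h t) := by
  refine ⟨_, isGeodesicSegment_edgePoint h hG hs hst ht, ?_⟩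
  rintro _ ⟨r, hr, rfl⟩
  have hr' : r ∈ Set.Icc (0 : ℝ) 1 := ⟨by linarith [hr.1], by linarith [hr.2]⟩
  rcases rdist_ofVertex_cases hG (edgePoint h r) w with ⟨h1, -⟩ | ⟨-, c, h1, h2, h3⟩ |
    ⟨-, c, -, -, h2, h3⟩
  · rcases eq_or_eq_of_edgePoint_coord_ne_zero h h1 with h2 | h2
    · exact absurd h2.symm haw
    · exact absurd h2.symm hbw
  · rcases eq_or_eq_of_edgePoint_coord_ne_zero h h2 with rfl | rfl
    · exact absurd h1 haw'
    · rw [edgePoint_coord_right h hr'] at h3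
      rcases htw with htw | htw
      · linarith [hr.2]
      · exact absurd h1 htw
  · linarith [coord_le_one (edgePoint h r) c]

/-- The midpoint of an edge. -/
noncomputable def midpoint {a b : V} (h : G.Adj a b) : MetricGraph G := edgePoint h (1 / 2)

section Midpoint

variable {a b : V} (h : G.Adj a b)

lemma midpoint_symm : midpoint h.symm = midpoint h := by
  have := edgePoint_symm h (t := 1 / 2) (by norm_num)
  rwa [show (1 : ℝ) - 1 / 2 = 1 / 2 by norm_num] at this

lemma midpoint_coord_left : (midpoint h).coord a = 1 / 2 := by
  rw [midpoint, edgePoint_coord_left h (by norm_num)]; norm_num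

lemma midpoint_coord_right : (midpoint h).coord b = 1 / 2 :=
  edgePoint_coord_right h (by norm_num)

lemma half_le_of_midpoint (c : V) (hc : (midpoint h).coord c ≠ 0) :
    (1 / 2 : ℝ) ≤ 1 - (midpoint h).coord c := by
  rcases eq_or_eq_of_edgePoint_coord_ne_zero h hc with rfl | rfl
  · rw [midpoint_coord_left]; norm_num
  · rw [midpoint_coord_right]; norm_num

lemma zero_le_of_ofVertex (a c : V) (_ : (ofVertex G a).coord c ≠ 0) :
    (0 : ℝ) ≤ 1 - (ofVertex G a).coord c := sub_nonneg.2 (coord_le_one _ _)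

lemma rdist_midpoint_le : rdist (midpoint h) (ofVertex G a) ≤ 1 / 2 := by
  have := rdist_le_of_common (x := midpoint h) (y := ofVertex G a) (a := a)
    (by rw [midpoint_coord_left]; norm_num) (by simp)
  rw [midpoint_coord_left, ofVertex_coord_self] at this
  linarith

lemma rdist_midpoint_le' : rdist (ofVertex G a) (midpoint h) ≤ 1 / 2 :=
  rdist_comm (midpoint h) (ofVertex G a) ▸ rdist_midpoint_le h

lemma rdist_ofVertex_le (h : G.Adj a b) : rdist (ofVertex G a) (ofVertex G b) ≤ 1 := by
  have := rdist_le_of_adj (x := ofVertex G a) (y := ofVertex G b) (by simp) (by simp) h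
  simpa using this

lemma rdist_midpoint_ofVertex_le {c : V} (hc : G.Adj a c) :
    rdist (midpoint h) (ofVertex G c) ≤ 3 / 2 := by
  have := rdist_le_of_adj (x := midpoint h) (y := ofVertex G c)
    (by rw [midpoint_coord_left]; norm_num) (by simp) hc
  rw [midpoint_coord_left, ofVertex_coord_self] at this
  linarith

lemma rdist_midpoint_ofVertex_le' (hG : ∀ a b, G.edist a b ≤ 2) (c : V) :
    rdist (midpoint h) (ofVertex G c) ≤ 5 / 2 := by
  have := rdist_le_two_add hG (x := midpoint h) (y := ofVertex G c) (a := a) (b := c)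
    (by rw [midpoint_coord_left]; norm_num) (by simp)
  rw [midpoint_coord_left, ofVertex_coord_self] at this
  linarith

variable {c d : V} (h' : G.Adj c d)

lemma le_rdist_midpoint_ofVertex (hG : ∀ a b, G.edist a b ≤ 2) (hac : a ≠ c) (hbc : b ≠ c) :
    3 / 2 ≤ rdist (midpoint h) (ofVertex G c) := by
  have := le_rdist_of_disjoint hG (half_le_of_midpoint h) (zero_le_of_ofVertex (G := G) c)
    (by
      intro p q hp hq
      obtain rfl := ofVertex_coord_ne_zero hq
      rcases eq_or_eq_of_edgePoint_coord_ne_zero h hp with rfl | rfl <;> assumption)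
  linarith

lemma le_rdist_midpoint_ofVertex' (hG : ∀ a b, G.edist a b ≤ 2) (hac : a ≠ c ∧ ¬ G.Adj a c)
    (hbc : b ≠ c ∧ ¬ G.Adj b c) : 5 / 2 ≤ rdist (midpoint h) (ofVertex G c) := by
  have := le_rdist_of_not_adj hG (half_le_of_midpoint h) (zero_le_of_ofVertex (G := G) c)
    (by
      intro p q hp hq
      obtain rfl := ofVertex_coord_ne_zero hq
      rcases eq_or_eq_of_edgePoint_coord_ne_zero h hp with rfl | rfl <;> assumption)
  linarith

lemma le_rdist_midpoint (hG : ∀ a b, G.edist a b ≤ 2) (hac : a ≠ c) (had : a ≠ d) (hbc : b ≠ c)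
    (hbd : b ≠ d) : 2 ≤ rdist (midpoint h) (midpoint h') := by
  have := le_rdist_of_disjoint hG (half_le_of_midpoint h) (half_le_of_midpoint h')
    (by
      intro p q hp hq
      rcases eq_or_eq_of_edgePoint_coord_ne_zero h hp with rfl | rfl <;>
      rcases eq_or_eq_of_edgePoint_coord_ne_zero h' hq with rfl | rfl <;> assumption)
  linarith

lemma le_rdist_midpoint' (hG : ∀ a b, G.edist a b ≤ 2) (hac : a ≠ c ∧ ¬ G.Adj a c)
    (had : a ≠ d ∧ ¬ G.Adj a d) (hbc : b ≠ c ∧ ¬ G.Adj b c) (hbd : b ≠ d ∧ ¬ G.Adj b d) :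
    3 ≤ rdist (midpoint h) (midpoint h') := by
  have := le_rdist_of_not_adj hG (half_le_of_midpoint h) (half_le_of_midpoint h')
    (by
      intro p q hp hq
      rcases eq_or_eq_of_edgePoint_coord_ne_zero h hp with rfl | rfl <;>
      rcases eq_or_eq_of_edgePoint_coord_ne_zero h' hq with rfl | rfl <;> assumption)
  linarith

end Midpoint

/-! ### Wings: geodesics that start at the midpoint of an edge and avoid the neighbours of the
centre. -/

section Wings

variable {a a' w u v z : V}

lemma farGeodesic_midpoint_ofVertex (hG : ∀ a b, G.edist a b ≤ 2) (h : G.Adj a' a) (ha : a ≠ w)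
    (ha' : a' ≠ w ∧ ¬ G.Adj a' w) : FarGeodesic w (midpoint h) (ofVertex G a') := by
  have := farGeodesic_edgePoint hG h ha'.1 ha'.2 ha (s := 0) (t := 1 / 2) le_rfl (by norm_num)
    (by norm_num) (Or.inl le_rfl)
  rw [edgePoint_zero] at this
  exact this.symm

lemma farGeodesic_ofVertex (hG : ∀ a b, G.edist a b ≤ 2) (h : G.Adj u v)
    (hu : u ≠ w ∧ ¬ G.Adj u w) (hv : v ≠ w ∧ ¬ G.Adj v w) :
    FarGeodesic w (ofVertex G u) (ofVertex G v) := by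
  have := farGeodesic_edgePoint hG h hu.1 hu.2 hv.1 (s := 0) (t := 1) le_rfl (by norm_num)
    le_rfl (Or.inr hv.2)
  rwa [edgePoint_zero, edgePoint_one] at this

/-- The geodesic `m(a' a), a', u`. -/
lemma farGeodesic_one (hG : ∀ a b, G.edist a b ≤ 2) (h : G.Adj a' a) (ha : a ≠ w)
    (ha' : a' ≠ w ∧ ¬ G.Adj a' w) (hu : u ≠ w ∧ ¬ G.Adj u w) (hau : G.Adj a' u) (hne : a ≠ u) :
    FarGeodesic w (midpoint h) (ofVertex G u) := by
  refine (farGeodesic_midpoint_ofVertex hG h ha ha').trans hG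
    (farGeodesic_ofVertex hG hau ha' hu) ?_
  linarith [rdist_midpoint_le h, rdist_ofVertex_le hau, le_rdist_midpoint_ofVertex h hG hau.ne hne]

/-- The geodesic `m(a' a), a', u, m(u v)`. -/
lemma farGeodesic_one_midpoint (hG : ∀ a b, G.edist a b ≤ 2) (h : G.Adj a' a) (ha : a ≠ w)
    (ha' : a' ≠ w ∧ ¬ G.Adj a' w) (hu : u ≠ w ∧ ¬ G.Adj u w) (hv : v ≠ w ∧ ¬ G.Adj v w)
    (hau : G.Adj a' u) (huv : G.Adj u v) (hne : a ≠ u) (hne' : a ≠ v) (hne'' : a' ≠ v) :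
    FarGeodesic w (midpoint h) (midpoint huv) := by
  refine (farGeodesic_one hG h ha ha' hu hau hne).trans hG
    (farGeodesic_midpoint_ofVertex hG huv hv.1 hu).symm ?_
  linarith [rdist_midpoint_ofVertex_le h hau, rdist_midpoint_le' huv,
    le_rdist_midpoint h huv hG hau.ne hne'' hne hne']

/-- The geodesic `m(a' a), a', u, v`. -/
lemma farGeodesic_two (hG : ∀ a b, G.edist a b ≤ 2) (h : G.Adj a' a) (ha : a ≠ w)
    (ha' : a' ≠ w ∧ ¬ G.Adj a' w) (hu : u ≠ w ∧ ¬ G.Adj u w) (hv : v ≠ w ∧ ¬ G.Adj v w)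
    (hau : G.Adj a' u) (huv : G.Adj u v) (hne : a ≠ u) (hav : a ≠ v ∧ ¬ G.Adj a v)
    (hav' : a' ≠ v ∧ ¬ G.Adj a' v) : FarGeodesic w (midpoint h) (ofVertex G v) := by
  refine (farGeodesic_one hG h ha ha' hu hau hne).trans hG (farGeodesic_ofVertex hG huv hu hv) ?_
  linarith [rdist_midpoint_ofVertex_le h hau, rdist_ofVertex_le huv,
    le_rdist_midpoint_ofVertex' h hG hav' hav]

/-- The geodesic `m(a' a), a', u, v, m(v z)`. -/
lemma farGeodesic_two_midpoint (hG : ∀ a b, G.edist a b ≤ 2) (h : G.Adj a' a) (ha : a ≠ w)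
    (ha' : a' ≠ w ∧ ¬ G.Adj a' w) (hu : u ≠ w ∧ ¬ G.Adj u w) (hv : v ≠ w ∧ ¬ G.Adj v w)
    (hz : z ≠ w ∧ ¬ G.Adj z w) (hau : G.Adj a' u) (huv : G.Adj u v) (hvz : G.Adj v z) (hne : a ≠ u)
    (hav : a ≠ v ∧ ¬ G.Adj a v) (hav' : a' ≠ v ∧ ¬ G.Adj a' v) (haz : a ≠ z ∧ ¬ G.Adj a z)
    (haz' : a' ≠ z ∧ ¬ G.Adj a' z) : FarGeodesic w (midpoint h) (midpoint hvz) := by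
  refine (farGeodesic_two hG h ha ha' hu hv hau huv hne hav hav').trans hG
    (farGeodesic_midpoint_ofVertex hG hvz hz.1 hv).symm ?_
  linarith [rdist_midpoint_ofVertex_le' h hG v, rdist_midpoint_le' hvz,
    le_rdist_midpoint' h hvz hG hav' haz' hav haz]

end Wings

/-- The geodesic `m(a a'), a, w`. -/
lemma isGeodesicSegment_to_center (hG : ∀ a b, G.edist a b ≤ 2) {a a' w : V} (h : G.Adj a a')
    (haw : G.Adj a w) (ha' : a' ≠ w) : ∃ S, IsGeodesicSegment (midpoint h) (ofVertex G w) S := by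
  have h1 := isGeodesicSegment_edgePoint h hG (s := 0) (t := 1 / 2) le_rfl (by norm_num)
    (by norm_num)
  have h2 := isGeodesicSegment_edgePoint haw hG (s := 0) (t := 1) le_rfl (by norm_num) le_rfl
  rw [edgePoint_zero] at h1 h2
  rw [edgePoint_one] at h2
  refine ⟨_, isGeodesicSegment_trans hG h1.symm h2 ?_⟩
  have h3 := rdist_midpoint_le h
  have h4 := le_rdist_midpoint_ofVertex h hG haw.ne ha'
  linarith [rdist_ofVertex_le haw]

/-- A triangle with a side `m(a a'), a, w, b, m(b b')` whose other sides stay away from `w`. -/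
lemma three_halves_le_of_farGeodesic (hG : ∀ a b, G.edist a b ≤ 2) {a a' b b' w : V}
    (ha : G.Adj a' a) (hb : G.Adj b' b) (haw : G.Adj a w) (hbw : G.Adj b w)
    (ha' : a' ≠ w) (hb' : b' ≠ w) (hab : a ≠ b ∧ ¬ G.Adj a b) (hab' : a ≠ b' ∧ ¬ G.Adj a b')
    (ha'b : a' ≠ b ∧ ¬ G.Adj a' b) (ha'b' : a' ≠ b' ∧ ¬ G.Adj a' b') {z : MetricGraph G}
    (hx : FarGeodesic w (midpoint ha) z) (hy : FarGeodesic w (midpoint hb) z) :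
    3 / 2 ≤ graphHyperbolicityConstant G := by
  have h32 : (3 / 2 : ℝ≥0∞) = ENNReal.ofReal (3 / 2) := by
    rw [ENNReal.ofReal_div_of_pos (by norm_num)]
    norm_num
  obtain ⟨S₁, h₁⟩ := isGeodesicSegment_to_center hG ha.symm haw ha'
  obtain ⟨S₂, h₂⟩ := isGeodesicSegment_to_center hG hb.symm hbw hb'
  rw [midpoint_symm ha] at h₁
  rw [midpoint_symm hb] at h₂
  have h0 : IsGeodesicSegment (midpoint ha) (midpoint hb) (S₁ ∪ S₂) := by
    refine isGeodesicSegment_trans hG h₁ h₂.symm ?_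
    -- Each half has length at most 3/2, and the midpoints are at distance at least 3 by the four
    -- non-adjacencies.
    have h3 := rdist_midpoint_ofVertex_le ha.symm haw
    have h4 := rdist_midpoint_ofVertex_le hb.symm hbw
    rw [midpoint_symm ha] at h3
    rw [midpoint_symm hb] at h4
    rw [rdist_comm (ofVertex G w)]
    linarith [le_rdist_midpoint' ha hb hG ha'b' ha'b hab' hab]
  obtain ⟨S, hS, hf⟩ := hx.symm
  obtain ⟨S', hS', hf'⟩ := hy
  let T : GeodesicTriangle (MetricGraph G) :=
    { vertex := ![midpoint ha, midpoint hb, z]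
      side := ![S₁ ∪ S₂, S', S]
      geodesic := by
        intro i
        fin_cases i
        · exact h0
        · exact hS'
        · exact hS }
  refine le_trans ?_ (le_iSup _ T)
  refine le_sInf fun δ hδ => ?_
  -- Thinness is tested at `w`, the middle of the first side.
  have := hδ 0 (ofVertex G w) (Or.inl h₁.right_mem)
  refine le_trans ?_ this
  rw [h32, Metric.le_infEDist]
  intro q hq
  rw [edist_comm, edist_eq_ofReal hG]
  apply ENNReal.ofReal_le_ofReal
  simp only [Set.mem_iUnion] at hq
  obtain ⟨j, hj, hq⟩ := hq
  fin_cases j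
  · exact absurd rfl hj
  · exact hf' q hq
  · exact hf q hq

end MetricGraph
end GraphHyp

/-! ### From paths between a' and b' to induced cycles with chords. -/

namespace GraphHyp

section Configurations

variable {V : Type u} {G : SimpleGraph V} {P : V → Prop}

/-- A graph of the family `𝒞` occurs as an induced subgraph on vertices that satisfy `P`. -/
def InducedOn {n : ℕ} (G : SimpleGraph V) (P : V → Prop) (𝒞 : Set (SimpleGraph (Fin n))) : Prop :=
  ∃ f : Fin n → V, Function.Injective f ∧ (∀ i, P (f i)) ∧ G.comap f ∈ 𝒞

/-- One of the graphs defining the family `𝓕` occurs as an induced subgraph on vertices that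
satisfy `P`. -/
def InducedFamily (G : SimpleGraph V) (P : V → Prop) : Prop :=
  InducedOn G P C6 ∨ InducedOn G P C7 ∨ InducedOn G P (C8₁ ∪ C8₂) ∨ InducedOn G P C9

lemma injective_of_lt {n : ℕ} {f : Fin n → V} (h : ∀ i j, i < j → f i ≠ f j) :
    Function.Injective f := by
  intro i j hij
  by_contra hne
  rcases lt_or_gt_of_ne hne with h' | h'
  · exact h i j h' hij
  · exact h j i h' hij.symm

/-- Restricting to `i < j` halves the finite checks; the set of chords is then whatever part of `E`
the induced subgraph contains. -/
lemma comap_mem_cycleWithChords {n : ℕ} {E : Set (Sym2 (Fin n))} {f : Fin n → V}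
    (hc : ∀ i j, i < j → (SimpleGraph.cycleGraph n).Adj i j → G.Adj (f i) (f j))
    (hn : ∀ i j, i < j → G.Adj (f i) (f j) → (SimpleGraph.cycleGraph n).Adj i j ∨ s(i, j) ∈ E) :
    G.comap f ∈ cycleWithChords n E := by
  have hc' : ∀ i j, (SimpleGraph.cycleGraph n).Adj i j → G.Adj (f i) (f j) := by
    intro i j h
    rcases lt_or_gt_of_ne h.ne with h' | h'
    · exact hc i j h' h
    · exact (hc j i h' h.symm).symm
  have hn' : ∀ i j, G.Adj (f i) (f j) → (SimpleGraph.cycleGraph n).Adj i j ∨ s(i, j) ∈ E := by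
    intro i j h
    rcases lt_trichotomy i j with h' | rfl | h'
    · exact hn i j h' h
    · exact absurd rfl h.ne
    · rw [Sym2.eq_swap, SimpleGraph.adj_comm]
      exact hn j i h' h.symm
  refine ⟨E ∩ (G.comap f).edgeSet, Set.inter_subset_left, ?_⟩
  ext i j
  simp only [SimpleGraph.comap_adj, SimpleGraph.sup_adj, SimpleGraph.fromEdgeSet_adj,
    Set.mem_inter_iff, SimpleGraph.mem_edgeSet]
  constructor
  · intro h
    rcases hn' i j h with h1 | h1
    · exact Or.inl h1
    · exact Or.inr ⟨⟨h1, h⟩, fun hij => h.ne (congrArg f hij)⟩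
  · rintro (h | ⟨⟨-, h⟩, -⟩)
    · exact hc' i j h
    · exact h

/-- The position of the geodesics `x, a, w, b, y`, where `x` is a point of the edge `a a'` and `y` is
a point of the edge `b b'`. -/
structure Core (G : SimpleGraph V) (P : V → Prop) (a a' w b b' : V) : Prop where
  adj_a : G.Adj a' a
  adj_b : G.Adj b' b
  adj_aw : G.Adj a w
  adj_bw : G.Adj b w
  far_a : a' ≠ w ∧ ¬ G.Adj a' w
  far_b : b' ≠ w ∧ ¬ G.Adj b' w
  far_ab : a ≠ b ∧ ¬ G.Adj a b
  far_ab' : a ≠ b' ∧ ¬ G.Adj a b'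
  far_a'b : a' ≠ b ∧ ¬ G.Adj a' b
  far_a'b' : a' ≠ b' ∧ ¬ G.Adj a' b'
  closed : ∀ u v, ¬ G.Adj u v → P u → P v
  center : P w

namespace Core

variable {a a' w b b' u₁ u₂ u₃ u₄ : V}

lemma symm (h : Core G P a a' w b b') : Core G P b b' w a a' where
  adj_a := h.adj_b
  adj_b := h.adj_a
  adj_aw := h.adj_bw
  adj_bw := h.adj_aw
  far_a := h.far_b
  far_b := h.far_a
  far_ab := ⟨h.far_ab.1.symm, fun h' => h.far_ab.2 h'.symm⟩
  far_ab' := ⟨h.far_a'b.1.symm, fun h' => h.far_a'b.2 h'.symm⟩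
  far_a'b := ⟨h.far_ab'.1.symm, fun h' => h.far_ab'.2 h'.symm⟩
  far_a'b' := ⟨h.far_a'b'.1.symm, fun h' => h.far_a'b'.2 h'.symm⟩
  closed := h.closed
  center := h.center

/-- `P` will say that a vertex lies in a given factor of the join, and non-adjacent vertices share
their factor. -/
lemma prop_of_far (h : Core G P a a' w b b') {u : V} (hu : u ≠ w ∧ ¬ G.Adj u w) : P u :=
  h.closed w u (fun h' => hu.2 h'.symm) h.center

/-- The vertex `b` is adjacent to `w`, so its factor is determined through `a'` instead. -/
lemma prop_b (h : Core G P a a' w b b') : P b := h.closed a' b h.far_a'b.2 (h.prop_of_far h.far_a)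

lemma ne_of_far (h : Core G P a a' w b b') {u : V} (hu : u ≠ w ∧ ¬ G.Adj u w) : u ≠ a := by
  rintro rfl
  exact hu.2 h.adj_aw

/-- The suffix counts the edges of the path from `a'` to `b'`. Here nothing more is needed: the only
adjacencies left open, `a u₁` and `b u₁`, are the optional chords of `C6`. -/
lemma inducedFamily_two (h : Core G P a a' w b b')
    (h₁ : u₁ ≠ w ∧ ¬ G.Adj u₁ w)
    (e₁ : G.Adj a' u₁) (e₂ : G.Adj u₁ b') : InducedFamily G P := by
  left
  have ha := h.symm.prop_b
  have hb := h.prop_b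
  have pa := h.prop_of_far h.far_a
  have pb := h.prop_of_far h.far_b
  have p₁ := h.prop_of_far h₁
  have n₁ := h.ne_of_far h₁
  have n₁' := h.symm.ne_of_far h₁
  -- The cycle is numbered so that `v₁, …, v₅` are `a', a, w, b, b'` and the path is traversed
  -- backwards, from `b'` to `a'`.
  obtain ⟨q1, q2, q3, q4, ⟨q5, q6⟩, ⟨q7, q8⟩, ⟨q9, q10⟩, ⟨q11, q12⟩, ⟨q13, q14⟩,
    ⟨q15, q16⟩, -, pw⟩ := h
  refine ⟨![a', a, w, b, b', u₁], injective_of_lt ?_, ?_,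
    comap_mem_cycleWithChords ?_ ?_⟩
  · have := q1.ne
    have := q2.ne
    have := q3.ne
    have := q4.ne
    have := e₁.ne
    have := e₂.ne
    simp [Fin.forall_fin_succ]
    grind
  · simp [Fin.forall_fin_succ, *]
  · simp [Fin.forall_fin_succ, SimpleGraph.cycleGraph_adj]
    grind [SimpleGraph.adj_comm]
  · simp [Fin.forall_fin_succ, SimpleGraph.cycleGraph_adj]
    grind [SimpleGraph.adj_comm]

lemma inducedOn_seven (h : Core G P a a' w b b')
    (h₁ : u₁ ≠ w ∧ ¬ G.Adj u₁ w) (h₂ : u₂ ≠ w ∧ ¬ G.Adj u₂ w)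
    (e₁ : G.Adj a' u₁) (e₂ : G.Adj u₁ u₂) (e₃ : G.Adj u₂ b')
    (f₁ : ¬ G.Adj a' u₂) (f₂ : ¬ G.Adj u₁ b') : InducedOn G P C7 := by
  have ha := h.symm.prop_b
  have hb := h.prop_b
  have pa := h.prop_of_far h.far_a
  have pb := h.prop_of_far h.far_b
  have p₁ := h.prop_of_far h₁
  have n₁ := h.ne_of_far h₁
  have n₁' := h.symm.ne_of_far h₁
  have p₂ := h.prop_of_far h₂
  have n₂ := h.ne_of_far h₂
  have n₂' := h.symm.ne_of_far h₂
  obtain ⟨q1, q2, q3, q4, ⟨q5, q6⟩, ⟨q7, q8⟩, ⟨q9, q10⟩, ⟨q11, q12⟩, ⟨q13, q14⟩,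
    ⟨q15, q16⟩, -, pw⟩ := h
  refine ⟨![a', a, w, b, b', u₂, u₁], injective_of_lt ?_, ?_,
    comap_mem_cycleWithChords ?_ ?_⟩
  · have := q1.ne
    have := q2.ne
    have := q3.ne
    have := q4.ne
    have := e₁.ne
    have := e₂.ne
    have := e₃.ne
    simp [Fin.forall_fin_succ]
    grind
  · simp [Fin.forall_fin_succ, *]
  · simp [Fin.forall_fin_succ, SimpleGraph.cycleGraph_adj]
    grind [SimpleGraph.adj_comm]
  · simp [Fin.forall_fin_succ, SimpleGraph.cycleGraph_adj]
    grind [SimpleGraph.adj_comm]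

/-- The middle vertex `u₂` is not adjacent to `a` or `b`, so the wings may meet at it: the first
family on `C_8`. -/
lemma inducedOn_eight (h : Core G P a a' w b b')
    (h₁ : u₁ ≠ w ∧ ¬ G.Adj u₁ w) (h₂ : u₂ ≠ w ∧ ¬ G.Adj u₂ w) (h₃ : u₃ ≠ w ∧ ¬ G.Adj u₃ w)
    (e₁ : G.Adj a' u₁) (e₂ : G.Adj u₁ u₂) (e₃ : G.Adj u₂ u₃) (e₄ : G.Adj u₃ b')
    (f₁ : ¬ G.Adj a' u₂) (f₂ : ¬ G.Adj a' u₃) (f₃ : u₁ ≠ u₃ ∧ ¬ G.Adj u₁ u₃)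
    (f₄ : ¬ G.Adj u₁ b') (f₅ : ¬ G.Adj u₂ b') (k₁ : ¬ G.Adj a u₂) (k₂ : ¬ G.Adj b u₂) :
    InducedOn G P (C8₁ ∪ C8₂) := by
  have ha := h.symm.prop_b
  have hb := h.prop_b
  have pa := h.prop_of_far h.far_a
  have pb := h.prop_of_far h.far_b
  have p₁ := h.prop_of_far h₁
  have n₁ := h.ne_of_far h₁
  have n₁' := h.symm.ne_of_far h₁
  have p₂ := h.prop_of_far h₂
  have n₂ := h.ne_of_far h₂
  have n₂' := h.symm.ne_of_far h₂
  have p₃ := h.prop_of_far h₃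
  have n₃ := h.ne_of_far h₃
  have n₃' := h.symm.ne_of_far h₃
  obtain ⟨q1, q2, q3, q4, ⟨q5, q6⟩, ⟨q7, q8⟩, ⟨q9, q10⟩, ⟨q11, q12⟩, ⟨q13, q14⟩,
    ⟨q15, q16⟩, -, pw⟩ := h
  refine ⟨![a', a, w, b, b', u₃, u₂, u₁], injective_of_lt ?_, ?_,
    Or.inl (comap_mem_cycleWithChords ?_ ?_)⟩
  · have := q1.ne
    have := q2.ne
    have := q3.ne
    have := q4.ne
    have := e₁.ne
    have := e₂.ne
    have := e₃.ne
    have := e₄.ne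
    simp [Fin.forall_fin_succ]
    grind
  · simp [Fin.forall_fin_succ, *]
  · simp [Fin.forall_fin_succ, SimpleGraph.cycleGraph_adj]
    grind [SimpleGraph.adj_comm]
  · simp [Fin.forall_fin_succ, SimpleGraph.cycleGraph_adj]
    grind [SimpleGraph.adj_comm]

/-- Now `a` misses both `u₂` and `u₃`, while all adjacencies of `b` to the path are free: the
second, asymmetric family on `C_8`. -/
lemma inducedOn_eight' (h : Core G P a a' w b b')
    (h₁ : u₁ ≠ w ∧ ¬ G.Adj u₁ w) (h₂ : u₂ ≠ w ∧ ¬ G.Adj u₂ w) (h₃ : u₃ ≠ w ∧ ¬ G.Adj u₃ w)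
    (e₁ : G.Adj a' u₁) (e₂ : G.Adj u₁ u₂) (e₃ : G.Adj u₂ u₃) (e₄ : G.Adj u₃ b')
    (f₁ : ¬ G.Adj a' u₂) (f₂ : ¬ G.Adj a' u₃) (f₃ : u₁ ≠ u₃ ∧ ¬ G.Adj u₁ u₃)
    (f₄ : ¬ G.Adj u₁ b') (f₅ : ¬ G.Adj u₂ b') (k₁ : ¬ G.Adj a u₂) (k₂ : ¬ G.Adj a u₃) :
    InducedOn G P (C8₁ ∪ C8₂) := by
  have ha := h.symm.prop_b
  have hb := h.prop_b
  have pa := h.prop_of_far h.far_a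
  have pb := h.prop_of_far h.far_b
  have p₁ := h.prop_of_far h₁
  have n₁ := h.ne_of_far h₁
  have n₁' := h.symm.ne_of_far h₁
  have p₂ := h.prop_of_far h₂
  have n₂ := h.ne_of_far h₂
  have n₂' := h.symm.ne_of_far h₂
  have p₃ := h.prop_of_far h₃
  have n₃ := h.ne_of_far h₃
  have n₃' := h.symm.ne_of_far h₃
  obtain ⟨q1, q2, q3, q4, ⟨q5, q6⟩, ⟨q7, q8⟩, ⟨q9, q10⟩, ⟨q11, q12⟩, ⟨q13, q14⟩,
    ⟨q15, q16⟩, -, pw⟩ := h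
  refine ⟨![a', a, w, b, b', u₃, u₂, u₁], injective_of_lt ?_, ?_,
    Or.inr (comap_mem_cycleWithChords ?_ ?_)⟩
  · have := q1.ne
    have := q2.ne
    have := q3.ne
    have := q4.ne
    have := e₁.ne
    have := e₂.ne
    have := e₃.ne
    have := e₄.ne
    simp [Fin.forall_fin_succ]
    grind
  · simp [Fin.forall_fin_succ, *]
  · simp [Fin.forall_fin_succ, SimpleGraph.cycleGraph_adj]
    grind [SimpleGraph.adj_comm]
  · simp [Fin.forall_fin_succ, SimpleGraph.cycleGraph_adj]
    grind [SimpleGraph.adj_comm]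

lemma inducedOn_nine (h : Core G P a a' w b b')
    (h₁ : u₁ ≠ w ∧ ¬ G.Adj u₁ w) (h₂ : u₂ ≠ w ∧ ¬ G.Adj u₂ w) (h₃ : u₃ ≠ w ∧ ¬ G.Adj u₃ w)
    (h₄ : u₄ ≠ w ∧ ¬ G.Adj u₄ w)
    (e₁ : G.Adj a' u₁) (e₂ : G.Adj u₁ u₂) (e₃ : G.Adj u₂ u₃) (e₄ : G.Adj u₃ u₄) (e₅ : G.Adj u₄ b')
    (f₁ : ¬ G.Adj a' u₂) (f₂ : ¬ G.Adj a' u₃) (f₃ : ¬ G.Adj a' u₄)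
    (f₄ : u₁ ≠ u₃ ∧ ¬ G.Adj u₁ u₃) (f₅ : u₁ ≠ u₄ ∧ ¬ G.Adj u₁ u₄) (f₆ : u₂ ≠ u₄ ∧ ¬ G.Adj u₂ u₄)
    (f₇ : ¬ G.Adj u₁ b') (f₈ : ¬ G.Adj u₂ b') (f₉ : ¬ G.Adj u₃ b')
    (k₁ : ¬ G.Adj a u₂) (k₂ : ¬ G.Adj b u₂) (k₃ : ¬ G.Adj a u₃) (k₄ : ¬ G.Adj b u₃) :
    InducedOn G P C9 := by
  have ha := h.symm.prop_b
  have hb := h.prop_b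
  have pa := h.prop_of_far h.far_a
  have pb := h.prop_of_far h.far_b
  have p₁ := h.prop_of_far h₁
  have n₁ := h.ne_of_far h₁
  have n₁' := h.symm.ne_of_far h₁
  have p₂ := h.prop_of_far h₂
  have n₂ := h.ne_of_far h₂
  have n₂' := h.symm.ne_of_far h₂
  have p₃ := h.prop_of_far h₃
  have n₃ := h.ne_of_far h₃
  have n₃' := h.symm.ne_of_far h₃
  have p₄ := h.prop_of_far h₄
  have n₄ := h.ne_of_far h₄
  have n₄' := h.symm.ne_of_far h₄
  obtain ⟨q1, q2, q3, q4, ⟨q5, q6⟩, ⟨q7, q8⟩, ⟨q9, q10⟩, ⟨q11, q12⟩, ⟨q13, q14⟩,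
    ⟨q15, q16⟩, -, pw⟩ := h
  refine ⟨![a', a, w, b, b', u₄, u₃, u₂, u₁], injective_of_lt ?_, ?_,
    comap_mem_cycleWithChords ?_ ?_⟩
  · have := q1.ne
    have := q2.ne
    have := q3.ne
    have := q4.ne
    have := e₁.ne
    have := e₂.ne
    have := e₃.ne
    have := e₄.ne
    have := e₅.ne
    simp [Fin.forall_fin_succ]
    grind
  · simp [Fin.forall_fin_succ, *]
  · simp [Fin.forall_fin_succ, SimpleGraph.cycleGraph_adj]
    grind [SimpleGraph.adj_comm]
  · simp [Fin.forall_fin_succ, SimpleGraph.cycleGraph_adj]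
    grind [SimpleGraph.adj_comm]

lemma inducedFamily_three (h : Core G P a a' w b b')
    (h₁ : u₁ ≠ w ∧ ¬ G.Adj u₁ w) (h₂ : u₂ ≠ w ∧ ¬ G.Adj u₂ w)
    (e₁ : G.Adj a' u₁) (e₂ : G.Adj u₁ u₂) (e₃ : G.Adj u₂ b') : InducedFamily G P := by
  by_cases f₁ : G.Adj a' u₂
  · exact h.inducedFamily_two h₂ f₁ e₃
  by_cases f₂ : G.Adj u₁ b'
  · exact h.inducedFamily_two h₁ e₁ f₂
  exact Or.inr (Or.inl (h.inducedOn_seven h₁ h₂ e₁ e₂ e₃ f₁ f₂))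

/-- A shortcut in the path reduces to two or three edges. Without shortcuts the path is induced, and
the three alternatives of `hk` give the first family on `C_8`, the second one, and the mirror image
of the second one. -/
lemma inducedFamily_four (h : Core G P a a' w b b')
    (h₁ : u₁ ≠ w ∧ ¬ G.Adj u₁ w) (h₂ : u₂ ≠ w ∧ ¬ G.Adj u₂ w) (h₃ : u₃ ≠ w ∧ ¬ G.Adj u₃ w)
    (e₁ : G.Adj a' u₁) (e₂ : G.Adj u₁ u₂) (e₃ : G.Adj u₂ u₃) (e₄ : G.Adj u₃ b')
    (hk : (¬ G.Adj a u₂ ∧ ¬ G.Adj b u₂) ∨ (¬ G.Adj a u₂ ∧ ¬ G.Adj a u₃) ∨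
      (¬ G.Adj b u₂ ∧ ¬ G.Adj b u₁)) : InducedFamily G P := by
  by_cases f₁ : G.Adj a' u₂
  · exact h.inducedFamily_three h₂ h₃ f₁ e₃ e₄
  by_cases f₂ : G.Adj a' u₃
  · exact h.inducedFamily_two h₃ f₂ e₄
  by_cases f₃ : u₁ = u₃
  · exact absurd (f₃ ▸ e₁) f₂
  by_cases f₃' : G.Adj u₁ u₃
  · exact h.inducedFamily_three h₁ h₃ e₁ f₃' e₄
  by_cases f₄ : G.Adj u₁ b'
  · exact h.inducedFamily_two h₁ e₁ f₄
  by_cases f₅ : G.Adj u₂ b'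
  · exact h.inducedFamily_three h₁ h₂ e₁ e₂ f₅
  refine Or.inr (Or.inr (Or.inl ?_))
  rcases hk with ⟨k₁, k₂⟩ | ⟨k₁, k₂⟩ | ⟨k₁, k₂⟩
  · exact h.inducedOn_eight h₁ h₂ h₃ e₁ e₂ e₃ e₄ f₁ f₂ ⟨f₃, f₃'⟩ f₄ f₅ k₁ k₂
  · exact h.inducedOn_eight' h₁ h₂ h₃ e₁ e₂ e₃ e₄ f₁ f₂ ⟨f₃, f₃'⟩ f₄ f₅ k₁ k₂
  · exact h.symm.inducedOn_eight' h₃ h₂ h₁ e₄.symm e₃.symm e₂.symm e₁.symm (fun h' => f₅ h'.symm)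
      (fun h' => f₄ h'.symm) ⟨Ne.symm f₃, fun h' => f₃' h'.symm⟩ (fun h' => f₂ h'.symm)
      (fun h' => f₁ h'.symm) k₁ k₂

/-- The inner vertices `u₂`, `u₃` are adjacent to none of `a`, `b`, so a shortcut to four edges
still satisfies the first alternative of `hk` there. -/
lemma inducedFamily_five (h : Core G P a a' w b b')
    (h₁ : u₁ ≠ w ∧ ¬ G.Adj u₁ w) (h₂ : u₂ ≠ w ∧ ¬ G.Adj u₂ w) (h₃ : u₃ ≠ w ∧ ¬ G.Adj u₃ w)
    (h₄ : u₄ ≠ w ∧ ¬ G.Adj u₄ w) (e₁ : G.Adj a' u₁) (e₂ : G.Adj u₁ u₂) (e₃ : G.Adj u₂ u₃)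
    (e₄ : G.Adj u₃ u₄) (e₅ : G.Adj u₄ b') (f₁ : ¬ G.Adj a' u₂) (f₂ : ¬ G.Adj a' u₃)
    (f₃ : ¬ G.Adj b' u₂) (f₄ : ¬ G.Adj b' u₃) (k₁ : ¬ G.Adj a u₂) (k₂ : ¬ G.Adj b u₂)
    (k₃ : ¬ G.Adj a u₃) (k₄ : ¬ G.Adj b u₃) : InducedFamily G P := by
  by_cases g₁ : G.Adj u₁ u₃
  · exact h.inducedFamily_four h₁ h₃ h₄ e₁ g₁ e₄ e₅ (Or.inl ⟨k₃, k₄⟩)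
  by_cases g₂ : G.Adj u₂ u₄
  · exact h.inducedFamily_four h₁ h₂ h₄ e₁ e₂ g₂ e₅ (Or.inl ⟨k₁, k₂⟩)
  by_cases g₃ : G.Adj a' u₄
  · exact h.inducedFamily_two h₄ g₃ e₅
  by_cases g₄ : G.Adj u₁ b'
  · exact h.inducedFamily_two h₁ e₁ g₄
  by_cases g₅ : G.Adj u₁ u₄
  · exact h.inducedFamily_three h₁ h₄ e₁ g₅ e₅
  refine Or.inr (Or.inr (Or.inr (h.inducedOn_nine h₁ h₂ h₃ h₄ e₁ e₂ e₃ e₄ e₅ f₁ f₂ g₃ ⟨?_, g₁⟩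
    ⟨?_, g₅⟩ ⟨?_, g₂⟩ g₄ (fun h' => f₃ h'.symm) (fun h' => f₄ h'.symm) k₁ k₂ k₃ k₄)))
  · rintro rfl
    exact f₂ e₁
  · rintro rfl
    exact g₃ e₁
  · rintro rfl
    exact f₃ e₅.symm

end Core

end Configurations

end GraphHyp

/-! ### Lower bound: each listed induced subgraph carries an extremal triangle. -/

namespace GraphHyp

section LowerBound

open MetricGraph

variable {V : Type u} {G : SimpleGraph V} {P : V → Prop} {n : ℕ} {E : Set (Sym2 (Fin n))}
  {f : Fin n → V}

lemma adj_of_mem_cycleWithChords (h : G.comap f ∈ cycleWithChords n E) {i j : Fin n}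
    (hij : (SimpleGraph.cycleGraph n).Adj i j) : G.Adj (f i) (f j) := by
  obtain ⟨S, -, hS⟩ := h
  have : (G.comap f).Adj i j := by rw [hS]; exact Or.inl hij
  exact this

lemma not_adj_of_mem_cycleWithChords (h : G.comap f ∈ cycleWithChords n E)
    (hf : Function.Injective f) {i j : Fin n}
    (hij : i ≠ j ∧ ¬ (SimpleGraph.cycleGraph n).Adj i j ∧ s(i, j) ∉ E) :
    f i ≠ f j ∧ ¬ G.Adj (f i) (f j) := by
  obtain ⟨S, hSE, hS⟩ := h
  refine ⟨hf.ne hij.1, fun hadj => ?_⟩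
  have : (G.comap f).Adj i j := hadj
  rw [hS] at this
  rcases this with h | h
  · exact hij.2.1 h
  · exact hij.2.2 (hSE ((SimpleGraph.fromEdgeSet_adj _).1 h).1)

/-- In all five cases `f 2` is the centre, and only the meeting point `z` of the wings changes. Here
it is the vertex `f 5`, and both wings have length 3/2. -/
lemma three_halves_le_of_C6 (hG : ∀ a b, G.edist a b ≤ 2) (h : InducedOn G P C6) :
    3 / 2 ≤ graphHyperbolicityConstant G := by
  obtain ⟨f, hf, -, h⟩ := h
  have A : ∀ i j, (SimpleGraph.cycleGraph 6).Adj i j → G.Adj (f i) (f j) :=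
    fun i j => adj_of_mem_cycleWithChords h
  have N : ∀ i j, i ≠ j ∧ ¬ (SimpleGraph.cycleGraph 6).Adj i j ∧ s(i, j) ∉ _ →
    f i ≠ f j ∧ ¬ G.Adj (f i) (f j) := fun i j => not_adj_of_mem_cycleWithChords h hf
  have D : ∀ i j, i ≠ j → f i ≠ f j := fun i j => hf.ne
  refine three_halves_le_of_farGeodesic hG (a := f 1) (a' := f 0) (b := f 3) (b' := f 4) (w := f 2)
    (z := ofVertex G (f 5)) (A 0 1 ?_) (A 4 3 ?_) (A 1 2 ?_) (A 3 2 ?_) (D 0 2 ?_) (D 4 2 ?_)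
    (N 1 3 ?_) (N 1 4 ?_) (N 0 3 ?_) (N 0 4 ?_)
    (farGeodesic_one hG (A 0 1 ?_) (D 1 2 ?_) (N 0 2 ?_) (N 5 2 ?_) (A 0 5 ?_) (D 1 5 ?_))
    (farGeodesic_one hG (A 4 3 ?_) (D 3 2 ?_) (N 4 2 ?_) (N 5 2 ?_) (A 4 5 ?_) (D 3 5 ?_)) <;>
  simp [SimpleGraph.cycleGraph_adj] <;> decide

/-- The wings meet at the midpoint of an edge and both have length 2. -/
lemma three_halves_le_of_C7 (hG : ∀ a b, G.edist a b ≤ 2) (h : InducedOn G P C7) :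
    3 / 2 ≤ graphHyperbolicityConstant G := by
  obtain ⟨f, hf, -, h⟩ := h
  have A : ∀ i j, (SimpleGraph.cycleGraph 7).Adj i j → G.Adj (f i) (f j) :=
    fun i j => adj_of_mem_cycleWithChords h
  have N : ∀ i j, i ≠ j ∧ ¬ (SimpleGraph.cycleGraph 7).Adj i j ∧ s(i, j) ∉ _ →
    f i ≠ f j ∧ ¬ G.Adj (f i) (f j) := fun i j => not_adj_of_mem_cycleWithChords h hf
  have D : ∀ i j, i ≠ j → f i ≠ f j := fun i j => hf.ne
  have e : G.Adj (f 6) (f 5) := A 6 5 (by simp [SimpleGraph.cycleGraph_adj])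
  refine three_halves_le_of_farGeodesic hG (a := f 1) (a' := f 0) (b := f 3) (b' := f 4) (w := f 2)
    (z := midpoint e) (A 0 1 ?_) (A 4 3 ?_) (A 1 2 ?_) (A 3 2 ?_) (D 0 2 ?_) (D 4 2 ?_)
    (N 1 3 ?_) (N 1 4 ?_) (N 0 3 ?_) (N 0 4 ?_)
    (farGeodesic_one_midpoint hG (A 0 1 ?_) (D 1 2 ?_) (N 0 2 ?_) (N 6 2 ?_) (N 5 2 ?_) (A 0 6 ?_) e
      (D 1 6 ?_) (D 1 5 ?_) (D 0 5 ?_))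
    (midpoint_symm e ▸ farGeodesic_one_midpoint hG (A 4 3 ?_) (D 3 2 ?_) (N 4 2 ?_) (N 5 2 ?_)
      (N 6 2 ?_) (A 4 5 ?_) e.symm (D 3 5 ?_) (D 3 6 ?_) (D 4 6 ?_)) <;>
  simp [SimpleGraph.cycleGraph_adj] <;> decide

/-- Both wings have length 5/2 and meet at the vertex `f 6`. -/
lemma three_halves_le_of_C8₁ (hG : ∀ a b, G.edist a b ≤ 2) (h : InducedOn G P C8₁) :
    3 / 2 ≤ graphHyperbolicityConstant G := by
  obtain ⟨f, hf, -, h⟩ := h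
  have A : ∀ i j, (SimpleGraph.cycleGraph 8).Adj i j → G.Adj (f i) (f j) :=
    fun i j => adj_of_mem_cycleWithChords h
  have N : ∀ i j, i ≠ j ∧ ¬ (SimpleGraph.cycleGraph 8).Adj i j ∧ s(i, j) ∉ _ →
    f i ≠ f j ∧ ¬ G.Adj (f i) (f j) := fun i j => not_adj_of_mem_cycleWithChords h hf
  have D : ∀ i j, i ≠ j → f i ≠ f j := fun i j => hf.ne
  refine three_halves_le_of_farGeodesic hG (a := f 1) (a' := f 0) (b := f 3) (b' := f 4) (w := f 2)
    (z := ofVertex G (f 6)) (A 0 1 ?_) (A 4 3 ?_) (A 1 2 ?_) (A 3 2 ?_) (D 0 2 ?_) (D 4 2 ?_)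
    (N 1 3 ?_) (N 1 4 ?_) (N 0 3 ?_) (N 0 4 ?_)
    (farGeodesic_two hG (A 0 1 ?_) (D 1 2 ?_) (N 0 2 ?_) (N 7 2 ?_) (N 6 2 ?_) (A 0 7 ?_) (A 7 6 ?_)
      (D 1 7 ?_) (N 1 6 ?_) (N 0 6 ?_))
    (farGeodesic_two hG (A 4 3 ?_) (D 3 2 ?_) (N 4 2 ?_) (N 5 2 ?_) (N 6 2 ?_) (A 4 5 ?_) (A 5 6 ?_)
      (D 3 5 ?_) (N 3 6 ?_) (N 4 6 ?_)) <;>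
  simp [SimpleGraph.cycleGraph_adj] <;> decide

/-- The wings have lengths 3 and 2. Only the long one, on the side of `f 1`, forbids chords to `f 5`
and `f 6`. -/
lemma three_halves_le_of_C8₂ (hG : ∀ a b, G.edist a b ≤ 2) (h : InducedOn G P C8₂) :
    3 / 2 ≤ graphHyperbolicityConstant G := by
  obtain ⟨f, hf, -, h⟩ := h
  have A : ∀ i j, (SimpleGraph.cycleGraph 8).Adj i j → G.Adj (f i) (f j) :=
    fun i j => adj_of_mem_cycleWithChords h
  have N : ∀ i j, i ≠ j ∧ ¬ (SimpleGraph.cycleGraph 8).Adj i j ∧ s(i, j) ∉ _ →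
    f i ≠ f j ∧ ¬ G.Adj (f i) (f j) := fun i j => not_adj_of_mem_cycleWithChords h hf
  have D : ∀ i j, i ≠ j → f i ≠ f j := fun i j => hf.ne
  have e : G.Adj (f 6) (f 5) := A 6 5 (by simp [SimpleGraph.cycleGraph_adj])
  refine three_halves_le_of_farGeodesic hG (a := f 1) (a' := f 0) (b := f 3) (b' := f 4) (w := f 2)
    (z := midpoint e) (A 0 1 ?_) (A 4 3 ?_) (A 1 2 ?_) (A 3 2 ?_) (D 0 2 ?_) (D 4 2 ?_)
    (N 1 3 ?_) (N 1 4 ?_) (N 0 3 ?_) (N 0 4 ?_)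
    (farGeodesic_two_midpoint hG (A 0 1 ?_) (D 1 2 ?_) (N 0 2 ?_) (N 7 2 ?_) (N 6 2 ?_) (N 5 2 ?_)
      (A 0 7 ?_) (A 7 6 ?_) e (D 1 7 ?_) (N 1 6 ?_) (N 0 6 ?_) (N 1 5 ?_) (N 0 5 ?_))
    (midpoint_symm e ▸ farGeodesic_one_midpoint hG (A 4 3 ?_) (D 3 2 ?_) (N 4 2 ?_) (N 5 2 ?_)
      (N 6 2 ?_) (A 4 5 ?_) e.symm (D 3 5 ?_) (D 3 6 ?_) (D 4 6 ?_)) <;>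
  simp [SimpleGraph.cycleGraph_adj] <;> decide

/-- Both wings have the maximal length 3. -/
lemma three_halves_le_of_C9 (hG : ∀ a b, G.edist a b ≤ 2) (h : InducedOn G P C9) :
    3 / 2 ≤ graphHyperbolicityConstant G := by
  obtain ⟨f, hf, -, h⟩ := h
  have A : ∀ i j, (SimpleGraph.cycleGraph 9).Adj i j → G.Adj (f i) (f j) :=
    fun i j => adj_of_mem_cycleWithChords h
  have N : ∀ i j, i ≠ j ∧ ¬ (SimpleGraph.cycleGraph 9).Adj i j ∧ s(i, j) ∉ _ →
    f i ≠ f j ∧ ¬ G.Adj (f i) (f j) := fun i j => not_adj_of_mem_cycleWithChords h hf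
  have D : ∀ i j, i ≠ j → f i ≠ f j := fun i j => hf.ne
  have e : G.Adj (f 7) (f 6) := A 7 6 (by simp [SimpleGraph.cycleGraph_adj])
  refine three_halves_le_of_farGeodesic hG (a := f 1) (a' := f 0) (b := f 3) (b' := f 4) (w := f 2)
    (z := midpoint e) (A 0 1 ?_) (A 4 3 ?_) (A 1 2 ?_) (A 3 2 ?_) (D 0 2 ?_) (D 4 2 ?_)
    (N 1 3 ?_) (N 1 4 ?_) (N 0 3 ?_) (N 0 4 ?_)
    (farGeodesic_two_midpoint hG (A 0 1 ?_) (D 1 2 ?_) (N 0 2 ?_) (N 8 2 ?_) (N 7 2 ?_) (N 6 2 ?_)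
      (A 0 8 ?_) (A 8 7 ?_) e (D 1 8 ?_) (N 1 7 ?_) (N 0 7 ?_) (N 1 6 ?_) (N 0 6 ?_))
    (midpoint_symm e ▸ farGeodesic_two_midpoint hG (A 4 3 ?_) (D 3 2 ?_) (N 4 2 ?_) (N 5 2 ?_)
      (N 6 2 ?_) (N 7 2 ?_) (A 4 5 ?_) (A 5 6 ?_) e.symm (D 3 5 ?_) (N 3 6 ?_) (N 4 6 ?_)
      (N 3 7 ?_) (N 4 7 ?_)) <;>
  simp [SimpleGraph.cycleGraph_adj] <;> decide

lemma InducedFamily.three_halves_le (hG : ∀ a b, G.edist a b ≤ 2) (h : InducedFamily G P) :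
    3 / 2 ≤ graphHyperbolicityConstant G := by
  rcases h with h | h | ⟨f, hf, hP, h | h⟩ | h
  · exact three_halves_le_of_C6 hG h
  · exact three_halves_le_of_C7 hG h
  · exact three_halves_le_of_C8₁ hG ⟨f, hf, hP, h⟩
  · exact three_halves_le_of_C8₂ hG ⟨f, hf, hP, h⟩
  · exact three_halves_le_of_C9 hG h

end LowerBound

/-! ### Adjacency and diameter of the join, and induced subgraphs of its factors. -/

section Join

variable {V₁ : Type u} {V₂ : Type v} (G₁ : SimpleGraph V₁) (G₂ : SimpleGraph V₂)

lemma graphJoin_adj_inl {a b : V₁} :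
    (graphJoin G₁ G₂).Adj (Sum.inl a) (Sum.inl b) ↔ G₁.Adj a b := by
  simp [graphJoin]

lemma graphJoin_adj_inr {a b : V₂} :
    (graphJoin G₁ G₂).Adj (Sum.inr a) (Sum.inr b) ↔ G₂.Adj a b := by
  simp [graphJoin]

lemma graphJoin_adj_inl_inr {a : V₁} {b : V₂} :
    (graphJoin G₁ G₂).Adj (Sum.inl a) (Sum.inr b) := by
  simp [graphJoin]

lemma edist_graphJoin_le [Nonempty V₁] [Nonempty V₂] (a b : V₁ ⊕ V₂) :
    (graphJoin G₁ G₂).edist a b ≤ 2 := by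
  have two : ∀ a b c, (graphJoin G₁ G₂).Adj a c → (graphJoin G₁ G₂).Adj c b →
      (graphJoin G₁ G₂).edist a b ≤ 2 := by
    intro a b c h1 h2
    refine SimpleGraph.edist_triangle (v := c).trans ?_
    rw [SimpleGraph.edist_eq_one_iff_adj.2 h1, SimpleGraph.edist_eq_one_iff_adj.2 h2]
    norm_num
  have one : ∀ a b, (graphJoin G₁ G₂).Adj a b → (graphJoin G₁ G₂).edist a b ≤ 2 := by
    intro a b h
    rw [SimpleGraph.edist_eq_one_iff_adj.2 h]
    norm_num
  obtain ⟨p⟩ := ‹Nonempty V₁›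
  obtain ⟨q⟩ := ‹Nonempty V₂›
  rcases a with a | a <;> rcases b with b | b
  · exact two _ _ (Sum.inr q) (graphJoin_adj_inl_inr _ _) (graphJoin_adj_inl_inr _ _).symm
  · exact one _ _ (graphJoin_adj_inl_inr _ _)
  · exact one _ _ (graphJoin_adj_inl_inr _ _).symm
  · exact two _ _ (Sum.inl p) (graphJoin_adj_inl_inr _ _).symm (graphJoin_adj_inl_inr _ _)

lemma inducedOn_left_iff {n : ℕ} (𝒞 : Set (SimpleGraph (Fin n))) :
    InducedOn (graphJoin G₁ G₂) (fun c => c.isLeft) 𝒞 ↔ G₁ ∈ containingInduced V₁ 𝒞 := by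
  constructor
  · rintro ⟨f, hf, hP, h⟩
    choose g hg using fun i => Sum.isLeft_iff.1 (hP i)
    refine ⟨_, h, ⟨⟨g, fun i j hij => hf (by rw [hg, hg, hij])⟩, ?_⟩⟩
    intro i j
    simp only [SimpleGraph.comap_adj, hg, graphJoin_adj_inl]
    rfl
  · rintro ⟨H, hH, ⟨g⟩⟩
    refine ⟨fun i => Sum.inl (g i), fun i j hij => g.injective (Sum.inl_injective hij),
      fun i => rfl, ?_⟩
    convert hH
    ext i j
    simp [graphJoin_adj_inl]

lemma inducedOn_right_iff {n : ℕ} (𝒞 : Set (SimpleGraph (Fin n))) :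
    InducedOn (graphJoin G₁ G₂) (fun c => c.isRight) 𝒞 ↔ G₂ ∈ containingInduced V₂ 𝒞 := by
  constructor
  · rintro ⟨f, hf, hP, h⟩
    choose g hg using fun i => Sum.isRight_iff.1 (hP i)
    refine ⟨_, h, ⟨⟨g, fun i j hij => hf (by rw [hg, hg, hij])⟩, ?_⟩⟩
    intro i j
    simp only [SimpleGraph.comap_adj, hg, graphJoin_adj_inr]
    rfl
  · rintro ⟨H, hH, ⟨g⟩⟩
    refine ⟨fun i => Sum.inr (g i), fun i j hij => g.injective (Sum.inr_injective hij),
      fun i => rfl, ?_⟩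
    convert hH
    ext i j
    simp [graphJoin_adj_inr]

lemma inducedFamily_left_iff :
    InducedFamily (graphJoin G₁ G₂) (fun c => c.isLeft) ↔ G₁ ∈ familyF V₁ := by
  simp only [InducedFamily, inducedOn_left_iff, familyF, F6, F7, F8, F9, Set.mem_union]
  tauto

lemma inducedFamily_right_iff :
    InducedFamily (graphJoin G₁ G₂) (fun c => c.isRight) ↔ G₂ ∈ familyF V₂ := by
  simp only [InducedFamily, inducedOn_right_iff, familyF, F6, F7, F8, F9, Set.mem_union]
  tauto

end Join

end GraphHyp

/-! ### How a geodesic runs through vertices and edges. -/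

namespace GraphHyp

namespace MetricGraph

variable {V : Type u} {G : SimpleGraph V}

/-- `γ` restricted to `[0, L]` is an isometric embedding. -/
def IsometricOn (γ : ℝ → MetricGraph G) (L : ℝ) : Prop :=
  ∀ s ∈ Set.Icc 0 L, ∀ t ∈ Set.Icc 0 L, rdist (γ s) (γ t) = |s - t|

lemma coord_eq_of_rdist_lt_one (hG : ∀ a b, G.edist a b ≤ 2) {x : MetricGraph G} {c : V}
    (h : rdist x (ofVertex G c) < 1) : x.coord c = 1 - rdist x (ofVertex G c) := by
  rcases rdist_ofVertex_cases hG x c with ⟨-, h1⟩ | ⟨-, a, -, -, h1⟩ | ⟨-, a, -, -, -, h1⟩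
  · linarith
  · linarith [coord_le_one x a]
  · linarith [coord_le_one x a]

lemma rdist_ofVertex_of_coord (hG : ∀ a b, G.edist a b ≤ 2) {x : MetricGraph G} {c : V}
    (h : x.coord c ≠ 0) : rdist x (ofVertex G c) = 1 - x.coord c := by
  rcases rdist_ofVertex_cases hG x c with ⟨-, h1⟩ | ⟨h1, -⟩ | ⟨h1, -⟩
  · exact h1
  · exact absurd h1 h
  · exact absurd h1 h

namespace IsometricOn

variable {γ : ℝ → MetricGraph G} {L : ℝ}

lemma rdist_eq (h : IsometricOn γ L) {s t : ℝ} (hs : 0 ≤ s) (hst : s ≤ t) (ht : t ≤ L) :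
    rdist (γ s) (γ t) = t - s := by
  rw [h s ⟨hs, hst.trans ht⟩ t ⟨hs.trans hst, ht⟩, abs_sub_comm, abs_of_nonneg (by linarith)]

/-- A geodesic that is at a vertex at time `t` is at an adjacent vertex at time `t + 1`. -/
lemma exists_next (hG : ∀ a b, G.edist a b ≤ 2) (h : IsometricOn γ L) {t : ℝ} {c : V} (ht : 0 ≤ t)
    (htL : t + 1 ≤ L) (hc : γ t = ofVertex G c) :
    ∃ e, G.Adj c e ∧ γ (t + 1) = ofVertex G e := by
  -- The position at time `t + 1 / 2` is the midpoint of an edge `c e`. The position at `t + 1` is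
  -- 1/2 away from it and not carried by `c`, which forces it to be `e`.
  have h1 : rdist (γ (t + 1 / 2)) (ofVertex G c) = 1 / 2 := by
    rw [rdist_comm, ← hc, h.rdist_eq ht (by linarith) (by linarith)]
    ring
  have h2 : rdist (γ (t + 1)) (ofVertex G c) = 1 := by
    rw [rdist_comm, ← hc, h.rdist_eq ht (by linarith) (by linarith)]
    ring
  have h3 : rdist (γ (t + 1 / 2)) (γ (t + 1)) = 1 / 2 := by
    rw [h.rdist_eq (by linarith) (by linarith) (by linarith)]
    ring
  generalize γ (t + 1 / 2) = q at *
  generalize γ (t + 1) = r at *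
  have hq := coord_eq_of_rdist_lt_one hG (x := q) (c := c) (by rw [h1]; norm_num)
  rw [h1] at hq
  obtain ⟨e, hce, hqe⟩ := exists_adj_of_coord_lt_one (x := q) (a := c) (by rw [hq]; norm_num)
    (by rw [hq]; norm_num)
  have hrc : r.coord c = 0 := by
    by_contra h0
    have := rdist_ofVertex_of_coord hG h0
    rw [h2] at this
    exact h0 (by linarith)
  refine ⟨e, hce, eq_ofVertex_of_coord_eq_one ?_⟩
  have hhalf : ∀ a, q.coord a ≠ 0 → q.coord a = 1 / 2 ∧ (a = c ∨ a = e) := by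
    intro a ha
    rcases eq_or_eq_of_coord_ne_zero hce.ne hqe ha with rfl | rfl
    · exact ⟨by linarith, Or.inl rfl⟩
    · exact ⟨by linarith, Or.inr rfl⟩
  rcases rdist_cases hG q r with ⟨a, b, hab, hx, hy, h4⟩ | ⟨a, ha, hb, h4⟩ |
    ⟨a, b, hab, ha, hb, h4⟩ | ⟨a, b, hne, hab, ha, hb, h4⟩
  · have hq' := (mem_edgeSegment_iff hab.ne).1 hx
    have hr' := ((mem_edgeSegment_iff hab.ne).1 hy).2.2.1
    have hc' : c = a ∨ c = b := by
      by_contra! h'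
      have := hq'.2.2.2 c h'.1 h'.2
      linarith
    have he' : e = a ∨ e = b := by
      by_contra! h'
      have := hq'.2.2.2 e h'.1 h'.2
      linarith
    rcases hc' with rfl | rfl <;> rcases he' with rfl | rfl
    · exact absurd rfl hce.ne
    · linarith
    · linarith
    · exact absurd rfl hce.ne
  · obtain ⟨h5, rfl | rfl⟩ := hhalf a ha
    · exact absurd hrc hb
    · linarith [coord_le_one r a]
  · linarith [(hhalf a ha).1, coord_le_one r b]
  · linarith [(hhalf a ha).1, coord_le_one r b]

/-- Near its end, a geodesic that passes through a vertex is on an edge at this vertex. -/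
lemma coord_last (hG : ∀ a b, G.edist a b ≤ 2) (h : IsometricOn γ L) {t : ℝ} {c : V} (ht : 0 ≤ t)
    (htL : t ≤ L) (hL : L < t + 1) (hc : γ t = ofVertex G c) : (γ L).coord c = 1 - (L - t) := by
  have h1 : rdist (γ L) (ofVertex G c) = L - t := by
    rw [rdist_comm, ← hc, h.rdist_eq ht htL le_rfl]
  rw [coord_eq_of_rdist_lt_one hG (by rw [h1]; linarith), h1]

/-- Since `s ≤ 1 / 2`, an exit through `b` cannot lie in the past at time `s`. At that time the
geodesic is at `a`, or has moved towards `b`; in the latter case its position at time `min (1 - s)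
L` decides between reaching `b` and ending inside the edge. -/
lemma leaves_edge_aux (hG : ∀ a b, G.edist a b ≤ 2) (h : IsometricOn γ L) {a b : V} {s : ℝ}
    (hL : 0 ≤ L) (hab : a ≠ b) (hs : 0 < s) (hs2 : s ≤ 1 / 2) (ha : (γ 0).coord a = 1 - s)
    (hb : (γ 0).coord b = s) :
    (s ≤ L ∧ γ s = ofVertex G a) ∨ (1 - s ≤ L ∧ γ (1 - s) = ofVertex G b) ∨
      (γ L).coord ∈ edgeSegment a b := by
  have hsum : (γ 0).coord a + (γ 0).coord b = 1 := by linarith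
  have hx : (γ 0).coord ∈ edgeSegment a b := mem_edgeSegment_of_coord hab hsum
  have hadj : G.Adj a b := (adj_of_coord_ne_zero (γ 0) hab (by rw [ha]; intro; linarith)
    (by rw [hb]; exact hs.ne')).1
  have hcarrier : ∀ (y : MetricGraph G) c d, G.Adj c d →
      y.coord a ≠ 0 → y.coord b ≠ 0 → y.coord ∈ edgeSegment c d →
      (c = a ∧ d = b) ∨ (c = b ∧ d = a) := by
    intro y c d hcd h1 h2 hy
    have h3 := ((mem_edgeSegment_iff hcd.ne).1 hy).2.2.2
    have h4 : a = c ∨ a = d := by by_contra! h'; exact h1 (h3 a h'.1 h'.2)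
    have h5 : b = c ∨ b = d := by by_contra! h'; exact h2 (h3 b h'.1 h'.2)
    rcases h4 with rfl | rfl <;> rcases h5 with rfl | rfl
    · exact absurd rfl hab
    · exact Or.inl ⟨rfl, rfl⟩
    · exact Or.inr ⟨rfl, rfl⟩
    · exact absurd rfl hab
  -- the points of the edge, or beyond `a` or `b`, at a given distance
  have key : ∀ (y z : MetricGraph G) (σ : ℝ), 0 < σ → σ < 1 → y.coord ∈ edgeSegment a b →
      y.coord a = 1 - σ → (z.coord ∈ edgeSegment a b ∧ rdist y z = |y.coord a - z.coord a|) ∨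
      (∃ c, z.coord c ≠ 0 ∧ ((c = a ∧ σ + (1 - z.coord c) ≤ rdist y z) ∨
        (c = b ∧ 1 - σ + (1 - z.coord c) ≤ rdist y z))) ∨ (σ + 1 ≤ rdist y z) ∨
        (1 - σ + 1 ≤ rdist y z) := by
    intro y z σ h0 h1 hy hya
    have hyb : y.coord b = σ := by linarith [((mem_edgeSegment_iff hab).1 hy).2.2.1]
    have hne : ∀ c, y.coord c ≠ 0 → c = a ∨ c = b := fun c hc =>
      eq_or_eq_of_coord_ne_zero hab (by linarith) hc
    rcases rdist_cases hG y z with ⟨c, d, hcd, hye, hze, h4⟩ | ⟨c, hc, hd, h4⟩ |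
      ⟨c, d, hcd, hc, hd, h4⟩ | ⟨c, d, hne', hcd, hc, hd, h4⟩
    · left
      rcases hcarrier y c d hcd (by rw [hya]; intro; linarith) (by rw [hyb]; exact h0.ne') hye
        with ⟨rfl, rfl⟩ | ⟨rfl, rfl⟩
      · exact ⟨hze, h4⟩
      · have hze' : z.coord ∈ edgeSegment d c := (segment_symm ℝ _ _).subset hze
        refine ⟨hze', h4.trans ?_⟩
        have h5 := ((mem_edgeSegment_iff hcd.ne).1 hze).2.2.1
        rw [abs_sub_comm (y.coord d)]
        congr 1
        linarith
    · right; left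
      refine ⟨c, hd, ?_⟩
      rcases hne c hc with rfl | rfl
      · exact Or.inl ⟨rfl, by linarith⟩
      · exact Or.inr ⟨rfl, by linarith⟩
    · right; right
      have := coord_le_one z d
      rcases hne c hc with rfl | rfl
      · exact Or.inl (by linarith)
      · exact Or.inr (by linarith)
    · right; right
      have := coord_le_one z d
      rcases hne c hc with rfl | rfl
      · exact Or.inl (by linarith)
      · exact Or.inr (by linarith)
  have hvert : ∀ (z : MetricGraph G) c, 1 ≤ z.coord c → z = ofVertex G c := fun z c hz =>
    eq_ofVertex_of_coord_eq_one (le_antisymm (coord_le_one z c) hz)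
  by_cases hsL : s ≤ L
  · have hr : rdist (γ 0) (γ s) = s := by
      rw [h.rdist_eq le_rfl hs.le hsL, sub_zero]
    rcases key (γ 0) (γ s) s hs (by linarith) hx ha with ⟨hre, h1⟩ |
      ⟨c, hc, ⟨rfl, h1⟩ | ⟨rfl, h1⟩⟩ | h1 | h1
    · rw [hr, ha] at h1
      obtain ⟨hra0, hrb0, hrab, -⟩ := (mem_edgeSegment_iff hab).1 hre
      rcases abs_cases (1 - s - (γ s).coord a) with ⟨h2, -⟩ | ⟨h2, -⟩
      -- The geodesic has moved towards `b`.
      · have hra : (γ s).coord a = 1 - 2 * s := by linarith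
        rcases eq_or_lt_of_le hs2 with rfl | hs2
        · right; left
          refine ⟨by linarith, ?_⟩
          rw [show (1 : ℝ) - 1 / 2 = 1 / 2 by norm_num]
          exact hvert _ _ (by linarith)
        · right
          -- the end point, or the point that should be `b`
          obtain ⟨m, hm, hsm, hmL, hm'⟩ : ∃ m, (m = 1 - s ∨ m = L) ∧ s ≤ m ∧ m ≤ L ∧ m ≤ 1 - s := by
            rcases le_total (1 - s) L with h' | h'
            · exact ⟨1 - s, Or.inl rfl, by linarith, h', le_rfl⟩
            · exact ⟨L, Or.inr rfl, hsL, le_rfl, h'⟩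
          have hd : rdist (γ s) (γ m) = m - s := h.rdist_eq hs.le hsm hmL
          have hd0 : rdist (γ 0) (γ m) = m := by
            rw [h.rdist_eq le_rfl (by linarith) hmL, sub_zero]
          have hfin : (γ m).coord ∈ edgeSegment a b ∧ (m = 1 - s → γ m = ofVertex G b) := by
            rcases key (γ s) (γ m) (2 * s) (by linarith) (by linarith) hre (by linarith) with
              ⟨hme, h3⟩ | ⟨c, hc, ⟨rfl, h3⟩ | ⟨rfl, h3⟩⟩ | h3 | h3
            · refine ⟨hme, fun hms => hvert _ _ ?_⟩
              obtain ⟨-, -, hmab, -⟩ := (mem_edgeSegment_iff hab).1 hme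
              have h5 := rdist_le_of_mem_edge hadj hx hme
              rw [hd0, ha] at h5
              rw [hd, hra] at h3
              rcases abs_cases (1 - 2 * s - (γ m).coord a) with ⟨h4, -⟩ | ⟨h4, -⟩ <;>
                rcases abs_cases (1 - s - (γ m).coord a) with ⟨h6, -⟩ | ⟨h6, -⟩ <;> linarith
            · have h5 := rdist_le_of_common (x := γ 0) (y := γ m) (a := c)
                (by rw [ha]; intro; linarith) hc
              linarith
            · have hmb := hvert (γ m) c (by linarith)
              refine ⟨?_, fun _ => hmb⟩
              rw [hmb]
              exact right_mem_segment ℝ _ _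
            · linarith
            · linarith
          rcases hm with hm | hm
          · left
            exact ⟨by linarith, hm ▸ hfin.2 hm⟩
          · right
            exact hm ▸ hfin.1
      · left
        exact ⟨hsL, hvert _ _ (by linarith)⟩
    · left
      exact ⟨hsL, hvert _ _ (by linarith)⟩
    · right; left
      have := coord_le_one (γ s) c
      have hs' : s = 1 / 2 := by linarith
      subst hs'
      refine ⟨by linarith, ?_⟩
      rw [show (1 : ℝ) - 1 / 2 = 1 / 2 by norm_num]
      exact hvert _ _ (by linarith)
    · linarith
    · linarith
  · push Not at hsL
    have hr : rdist (γ 0) (γ L) = L := by rw [h.rdist_eq le_rfl hL le_rfl, sub_zero]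
    rcases key (γ 0) (γ L) s hs (by linarith) hx ha with ⟨hre, -⟩ | ⟨c, hc, ⟨rfl, h1⟩ | ⟨rfl, h1⟩⟩ |
      h1 | h1
    · exact Or.inr (Or.inr hre)
    · linarith [coord_le_one (γ L) c]
    · linarith [coord_le_one (γ L) c]
    · linarith
    · linarith

/-- A geodesic that starts inside an edge ends on this edge or passes through an endpoint. -/
lemma leaves_edge (hG : ∀ a b, G.edist a b ≤ 2) (h : IsometricOn γ L) {a b : V} {s : ℝ}
    (hL : 0 ≤ L) (hab : a ≠ b) (hs : 0 < s) (hs1 : s < 1) (ha : (γ 0).coord a = 1 - s)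
    (hb : (γ 0).coord b = s) :
    (s ≤ L ∧ γ s = ofVertex G a) ∨ (1 - s ≤ L ∧ γ (1 - s) = ofVertex G b) ∨
      (γ L).coord ∈ edgeSegment a b := by
  rcases le_total s (1 / 2) with h2 | h2
  · exact leaves_edge_aux hG h hL hab hs h2 ha hb
  · have := leaves_edge_aux hG h hL hab.symm (s := 1 - s) (by linarith) (by linarith)
      (by rw [hb]; ring) ha
    rw [sub_sub_cancel] at this
    rcases this with h | h | h
    · exact Or.inr (Or.inl h)
    · exact Or.inl h
    · exact Or.inr (Or.inr ((segment_symm ℝ _ _).subset h))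

end IsometricOn

end MetricGraph
end GraphHyp

/-! ### Upper part: nearly extremal triangles contain a listed induced subgraph. -/

namespace GraphHyp

open MetricGraph

variable {V : Type u} {G : SimpleGraph V} {P : V → Prop} {a a' w b b' : V}

lemma far_of_lt_rdist {u : V} (h : 1 < rdist (ofVertex G u) (ofVertex G w)) :
    u ≠ w ∧ ¬ G.Adj u w := by
  constructor
  · rintro rfl
    rw [rdist, edist_self] at h
    norm_num at h
  · intro hadj
    linarith [rdist_ofVertex_le hadj]

/-- A geodesic from a point `x` of the edge `a a'` (at distance `s` from `a`) to `z`, of length `L`,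
passes through `a'`, avoids the neighbours of `w`, and then has at most two more vertices. -/
def Reaches (G : SimpleGraph V) (w a a' : V) (s L : ℝ) (z : MetricGraph G) : Prop :=
  (a' ≠ w ∧ ¬ G.Adj a' w) ∧ ∃ τ, 0 ≤ τ ∧ τ < 1 ∧
    ((z.coord a' = 1 - τ ∧ L = 1 - s + τ) ∨
    (∃ u₁, G.Adj a' u₁ ∧ (u₁ ≠ w ∧ ¬ G.Adj u₁ w) ∧ z.coord u₁ = 1 - τ ∧ L = 2 - s + τ) ∨
    (∃ u₁ u₂, G.Adj a' u₁ ∧ (u₁ ≠ w ∧ ¬ G.Adj u₁ w) ∧ G.Adj u₁ u₂ ∧ (u₂ ≠ w ∧ ¬ G.Adj u₂ w) ∧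
      z.coord u₂ = 1 - τ ∧ L = 3 - s + τ ∧ ¬ G.Adj a u₂ ∧ ¬ G.Adj a' u₂))

/-- An exit through `a` would come within distance 1 of `w`, so a geodesic that leaves the edge does
so through `a'`. After that it visits a vertex at each unit of time, and `L ≤ 3` leaves room for
two. -/
lemma reaches_of_isometricOn (hG : ∀ a b, G.edist a b ≤ 2) {γ : ℝ → MetricGraph G} {L s : ℝ}
    (h : IsometricOn γ L) (hL : 0 ≤ L) (hL3 : L ≤ 3) (hne : a ≠ a') (hs : 9 / 20 < s)
    (hs' : s < 11 / 20) (ha : (γ 0).coord a = 1 - s) (ha' : (γ 0).coord a' = s)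
    (haw : G.Adj a w) (hfar : ∀ t ∈ Set.Icc 0 L, 1 < rdist (γ t) (ofVertex G w)) :
    (γ L).coord ∈ edgeSegment a a' ∨ Reaches G w a a' s L (γ L) := by
  rcases h.leaves_edge hG hL hne (by linarith) (by linarith) ha ha' with ⟨h1, h2⟩ | ⟨h1, h2⟩ | h1
  · have := hfar s ⟨by linarith, h1⟩
    rw [h2] at this
    exact absurd haw (far_of_lt_rdist this).2
  · right
    have far : ∀ t u, 0 ≤ t → t ≤ L → γ t = ofVertex G u → u ≠ w ∧ ¬ G.Adj u w := by
      intro t u h0 ht hu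
      exact far_of_lt_rdist (hu ▸ hfar t ⟨h0, ht⟩)
    refine ⟨far _ a' (by linarith) h1 h2, ?_⟩
    by_cases h3 : L < 1 - s + 1
    · refine ⟨L - (1 - s), by linarith, by linarith, Or.inl ⟨?_, by ring⟩⟩
      exact h.coord_last hG (by linarith) h1 h3 h2
    push Not at h3
    obtain ⟨u₁, e₁, h4⟩ := h.exists_next hG (by linarith) h3 h2
    have f₁ := far _ u₁ (by linarith) h3 h4
    by_cases h5 : L < 1 - s + 1 + 1
    · refine ⟨L - (1 - s + 1), by linarith, by linarith, Or.inr (Or.inl ⟨u₁, e₁, f₁, ?_, by ring⟩)⟩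
      exact h.coord_last hG (by linarith) h3 h5 h4
    push Not at h5
    obtain ⟨u₂, e₂, h6⟩ := h.exists_next hG (by linarith) h5 h4
    have f₂ := far _ u₂ (by linarith) h5 h6
    -- An edge from `a` or `a'` to `u₂` would give a distance of at most `s + 1` or `(1 - s) + 1`.
    have hd : rdist (γ 0) (ofVertex G u₂) = 3 - s := by
      rw [← h6, h.rdist_eq le_rfl (by linarith) h5]
      ring
    refine ⟨L - (1 - s + 1 + 1), by linarith, by linarith,
      Or.inr (Or.inr ⟨u₁, u₂, e₁, f₁, e₂, f₂, ?_, by ring, ?_, ?_⟩)⟩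
    · exact h.coord_last hG (by linarith) h5 (by linarith) h6
    · intro hadj
      have := rdist_le_of_adj (x := γ 0) (y := ofVertex G u₂) (by rw [ha]; intro; linarith)
        (by simp) hadj
      rw [ofVertex_coord_self] at this
      linarith
    · intro hadj
      have := rdist_le_of_adj (x := γ 0) (y := ofVertex G u₂) (by rw [ha']; intro; linarith)
        (by simp) hadj
      rw [ofVertex_coord_self] at this
      linarith
  · exact Or.inl h1

/-- The last vertex of the other wing carries `z` and is far from `w`, so it can only be `a'`. Then
the wing itself is the path from `b'` to `a'`. -/
lemma Core.inducedFamily_of_mem_edge (h : Core G P a a' w b b') {z : MetricGraph G}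
    (hz : z.coord ∈ edgeSegment a a') {t L : ℝ} (hr : Reaches G w b b' t L z) :
    InducedFamily G P := by
  have hcar : ∀ c, z.coord c ≠ 0 → c = a ∨ c = a' := by
    intro c hc
    by_contra! h'
    exact hc (((mem_edgeSegment_iff h.adj_a.ne').1 hz).2.2.2 c h'.1 h'.2)
  obtain ⟨-, τ, h0, h1, ⟨h2, -⟩ | ⟨u₁, e₁, f₁, h2, -⟩ | ⟨u₁, u₂, e₁, f₁, e₂, f₂, h2, -⟩⟩ := hr
  · rcases hcar b' (by rw [h2]; intro; linarith) with h3 | h3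
    · exact absurd h3.symm h.far_ab'.1
    · exact absurd h3.symm h.far_a'b'.1
  · rcases hcar u₁ (by rw [h2]; intro; linarith) with h3 | h3
    · exact absurd h3 (h.ne_of_far f₁)
    · exact absurd (h3 ▸ e₁.symm) h.far_a'b'.2
  · rcases hcar u₂ (by rw [h2]; intro; linarith) with h3 | h3
    · exact absurd h3 (h.ne_of_far f₂)
    · exact h.inducedFamily_two f₁ (h3 ▸ e₂.symm) e₁.symm

/-- The two wings have length `2` and `1`, and `z` lies inside the edge between their ends. -/
lemma Core.inducedFamily_of_two_one (h : Core G P a a' w b b') {x y z : MetricGraph G} {s t τ : ℝ}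
    {u₁ u₂ u₃ : V} (h0 : 0 < τ) (h1 : τ < 1) (hs' : s < 11 / 20) (ht' : t < 11 / 20)
    (hxa : x.coord a = 1 - s) (hyb : y.coord b = 1 - t)
    (h₁ : u₁ ≠ w ∧ ¬ G.Adj u₁ w) (h₂ : u₂ ≠ w ∧ ¬ G.Adj u₂ w) (h₃ : u₃ ≠ w ∧ ¬ G.Adj u₃ w)
    (e₁ : G.Adj a' u₁) (e₂ : G.Adj u₁ u₂) (e₃ : G.Adj u₂ u₃) (e₄ : G.Adj u₃ b')
    (hz₂ : z.coord u₂ = 1 - τ) (hz₃ : z.coord u₃ = τ) (hxz : rdist x z = 3 - s + τ)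
    (hyz : rdist y z = 2 - t + (1 - τ)) (k₁ : ¬ G.Adj a u₂) : InducedFamily G P := by
  refine h.inducedFamily_four h₁ h₂ h₃ e₁ e₂ e₃ e₄ ?_
  -- Otherwise `b` is adjacent to `u₂` and `a` to `u₃`. The first shortcut forces `t + τ ≥ 1`, the
  -- second `s ≥ 1 / 2 + τ`, incompatible with `s, t < 11 / 20`.
  by_contra! hcon
  have c₁ := hcon.1 k₁
  have c₂ := hcon.2.1 k₁
  have d₁ := rdist_le_of_adj (x := y) (y := z) (by rw [hyb]; intro; linarith)
    (by rw [hz₂]; intro; linarith) c₁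
  have d₂ := rdist_le_of_adj (x := x) (y := z) (by rw [hxa]; intro; linarith)
    (by rw [hz₃]; intro; linarith) c₂
  linarith

lemma Core.inducedFamily_of_reaches (h : Core G P a a' w b b') {x y z : MetricGraph G} {s t : ℝ}
    (hs : 9 / 20 < s) (hs' : s < 11 / 20) (ht : 9 / 20 < t) (ht' : t < 11 / 20)
    (hxa : x.coord a = 1 - s) (hxa' : x.coord a' = s) (hyb : y.coord b = 1 - t)
    (hyb' : y.coord b' = t) (hxz : rdist x z ≤ 3) (hyz : rdist y z ≤ 3)
    (hx : Reaches G w a a' s (rdist x z) z) (hy : Reaches G w b b' t (rdist y z) z) :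
    InducedFamily G P := by
  -- The final vertices of the two wings both carry `z`, so they coincide or span the edge
  -- containing `z`.
  have meet : ∀ {u v : V} {τ σ : ℝ}, τ < 1 → σ < 1 → z.coord u = 1 - τ → z.coord v = 1 - σ →
      u = v ∨ (G.Adj u v ∧ σ = 1 - τ ∧ 0 < τ) := by
    intro u v τ σ h1 h2 h3 h4
    by_cases huv : u = v
    · exact Or.inl huv
    · obtain ⟨h5, h6⟩ := adj_of_coord_ne_zero z huv (by rw [h3]; intro; linarith)
        (by rw [h4]; intro; linarith)
      exact Or.inr ⟨h5, by linarith, by linarith⟩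
  obtain ⟨-, τ, h0, h1, ⟨h2, hL⟩ | ⟨u₁, e₁, f₁, h2, hL⟩ |
    ⟨u₁, u₂, e₁, f₁, e₂, f₂, h2, hL, k₁, k₂⟩⟩ := hx <;>
  obtain ⟨-, σ, h0', h1', ⟨h2', hL'⟩ | ⟨v₁, e₁', f₁', h2', hL'⟩ |
    ⟨v₁, v₂, e₁', f₁', e₂', f₂', h2', hL', k₁', k₂'⟩⟩ := hy <;>
  obtain rfl | ⟨huv, hσ, hτ⟩ := meet h1 h1' h2 h2'
  · exact absurd rfl h.far_a'b'.1
  · exact absurd huv h.far_a'b'.2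
  · exact absurd e₁'.symm h.far_a'b'.2
  · exact h.inducedFamily_two f₁' huv e₁'.symm
  · exact h.inducedFamily_two f₁' e₂'.symm e₁'.symm
  · exact h.inducedFamily_three f₂' f₁' huv e₂'.symm e₁'.symm
  · exact absurd e₁ h.far_a'b'.2
  · exact h.inducedFamily_two f₁ e₁ huv
  · exact h.inducedFamily_two f₁ e₁ e₁'.symm
  · exact h.inducedFamily_three f₁ f₁' e₁ huv e₁'.symm
  · exact h.inducedFamily_three f₁ f₁' e₁ e₂'.symm e₁'.symm
  · exact h.symm.inducedFamily_of_two_one (x := y) (y := x) (z := z) (τ := σ) (by linarith) h1'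
      ht' hs' hyb hxa f₁' f₂' f₁ e₁' e₂' huv.symm e₁.symm h2' (by linarith) hL' (by linarith) k₁'
  · exact h.inducedFamily_two f₁ e₁ e₂
  · exact h.inducedFamily_three f₁ f₂ e₁ e₂ huv
  · exact h.inducedFamily_three f₁ f₂ e₁ e₂ e₁'.symm
  · exact h.inducedFamily_of_two_one (x := x) (y := y) (z := z) hτ h1 hs' ht' hxa hyb f₁ f₂ f₁' e₁
      e₂ huv e₁'.symm h2 (by linarith) hL (by linarith) k₁
  · exact h.inducedFamily_four f₁ f₂ f₁' e₁ e₂ e₂'.symm e₁'.symm (Or.inl ⟨k₁, k₁'⟩)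
  -- Both lengths are at most 3, so `τ ≤ s` and `1 - τ ≤ t`: `z` is almost the midpoint of `u₂ v₂`.
  -- A chord from an end of the edge of `x` or `y` to the far end of this edge would give a path
  -- shorter than 11/20 + 1 + 11/20, but both wings are longer than 49/20.
  · have no : ∀ {p : MetricGraph G} {c d : V} {ρ : ℝ}, p.coord c ≠ 0 → 1 - p.coord c < 11 / 20 →
        z.coord d = ρ → 9 / 20 ≤ ρ → 49 / 20 ≤ rdist p z → ¬ G.Adj c d := by
      intro p c d ρ h3 h4 h5 h6 h7 hadj
      have := rdist_le_of_adj (x := p) (y := z) h3 (by rw [h5]; intro; linarith) hadj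
      linarith
    refine h.inducedFamily_five f₁ f₂ f₂' f₁' e₁ e₂ huv e₂'.symm e₁'.symm k₂ ?_ ?_ k₂' k₁ ?_ ?_ k₁'
    · exact no (p := x) (by rw [hxa']; intro; linarith) (by linarith) h2' (by linarith)
        (by linarith)
    · exact no (p := y) (by rw [hyb']; intro; linarith) (by linarith) h2 (by linarith) (by linarith)
    · exact no (p := y) (by rw [hyb]; intro; linarith) (by linarith) h2 (by linarith) (by linarith)
    · exact no (p := x) (by rw [hxa]; intro; linarith) (by linarith) h2' (by linarith) (by linarith)

/-- If one wing never leaves its edge, the far position of `a'` is read off the other wing: its last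
vertex carries `z`, and it is not `a`, which is adjacent to `w`. -/
lemma far_of_mem_edge (hne : a ≠ a') (haw : G.Adj a w) {z : MetricGraph G}
    (hz : z.coord ∈ edgeSegment a a') {t L : ℝ} (hr : Reaches G w b b' t L z) :
    a' ≠ w ∧ ¬ G.Adj a' w := by
  have key : ∀ c, z.coord c ≠ 0 → (c ≠ w ∧ ¬ G.Adj c w) → a' ≠ w ∧ ¬ G.Adj a' w := by
    intro c hc hf
    have hca : c ≠ a := by
      rintro rfl
      exact hf.2 haw
    have hca' : c = a' := by
      by_contra h'
      exact hc (((mem_edgeSegment_iff hne).1 hz).2.2.2 c hca h')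
    exact hca' ▸ hf
  obtain ⟨hf, τ, h0, h1, ⟨h2, -⟩ | ⟨u₁, e₁, f₁, h2, -⟩ | ⟨u₁, u₂, e₁, f₁, e₂, f₂, h2, -⟩⟩ := hr
  · exact key b' (by rw [h2]; intro; linarith) hf
  · exact key u₁ (by rw [h2]; intro; linarith) f₁
  · exact key u₂ (by rw [h2]; intro; linarith) f₂

lemma inducedFamily_of_isometricOn (hG : ∀ a b, G.edist a b ≤ 2)
    (adj_a : G.Adj a' a) (adj_b : G.Adj b' b) (adj_aw : G.Adj a w) (adj_bw : G.Adj b w)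
    (far : ∀ p q, p = a ∨ p = a' → q = b ∨ q = b' → p ≠ q ∧ ¬ G.Adj p q)
    (closed : ∀ u v, ¬ G.Adj u v → P u → P v) (center : P w)
    {γ η : ℝ → MetricGraph G} {L M s t : ℝ} (hγ : IsometricOn γ L) (hη : IsometricOn η M)
    (hL : 0 ≤ L) (hM : 0 ≤ M) (hs : 9 / 20 < s) (hs' : s < 11 / 20) (ht : 9 / 20 < t)
    (ht' : t < 11 / 20) (hxa : (γ 0).coord a = 1 - s) (hxa' : (γ 0).coord a' = s)
    (hyb : (η 0).coord b = 1 - t) (hyb' : (η 0).coord b' = t) (hz : γ L = η M)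
    (hfγ : ∀ r ∈ Set.Icc 0 L, 1 < rdist (γ r) (ofVertex G w))
    (hfη : ∀ r ∈ Set.Icc 0 M, 1 < rdist (η r) (ofVertex G w)) : InducedFamily G P := by
  have hxz : rdist (γ 0) (γ L) = L := by rw [hγ.rdist_eq le_rfl hL le_rfl, sub_zero]
  have hyz : rdist (η 0) (γ L) = M := by rw [hz, hη.rdist_eq le_rfl hM le_rfl, sub_zero]
  have hL3 := rdist_le_three hG (γ 0) (γ L)
  have hM3 := rdist_le_three hG (η 0) (γ L)
  have h1 := reaches_of_isometricOn hG hγ hL (by linarith) adj_a.ne' hs hs' hxa hxa' adj_aw hfγ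
  have h2 := reaches_of_isometricOn hG hη hM (by linarith) adj_b.ne' ht ht' hyb hyb' adj_bw hfη
  rw [← hz] at h2
  have core : (a' ≠ w ∧ ¬ G.Adj a' w) → (b' ≠ w ∧ ¬ G.Adj b' w) → Core G P a a' w b b' :=
    fun fa fb => ⟨adj_a, adj_b, adj_aw, adj_bw, fa, fb, far a b (.inl rfl) (.inl rfl),
      far a b' (.inl rfl) (.inr rfl), far a' b (.inr rfl) (.inl rfl),
      far a' b' (.inr rfl) (.inr rfl), closed, center⟩
  rcases h1 with h1 | h1 <;> rcases h2 with h2 | h2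
  -- Both wings staying on their edges would put `z` on two disjoint edges.
  · exfalso
    have h3 := ((mem_edgeSegment_iff adj_a.ne').1 h1).2.2.2
    rcases coord_ne_zero_or_of_mem adj_b.ne' h2 with h4 | h4
    · exact h4 (h3 b (far a b (.inl rfl) (.inl rfl)).1.symm (far a' b (.inr rfl) (.inl rfl)).1.symm)
    · exact h4 (h3 b' (far a b' (.inl rfl) (.inr rfl)).1.symm
        (far a' b' (.inr rfl) (.inr rfl)).1.symm)
  · exact (core (far_of_mem_edge adj_a.ne' adj_aw h1 h2) h2.1).inducedFamily_of_mem_edge h1 h2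
  · exact (core h1.1 (far_of_mem_edge adj_b.ne' adj_bw h2 h1)).symm.inducedFamily_of_mem_edge h2 h1
  · exact (core h1.1 h2.1).inducedFamily_of_reaches hs hs' ht ht' hxa hxa' hyb hyb' hL3 hM3
      (by rwa [hxz]) (by rwa [hyz])

/-- A nearly extremal geodesic triangle produces one of the induced subgraphs. -/
lemma exists_center_of_isometricOn (hG : ∀ a b, G.edist a b ≤ 2) {γ η θ : ℝ → MetricGraph G}
    {L M N r : ℝ} (hγ : IsometricOn γ L) (hη : IsometricOn η M) (hθ : IsometricOn θ N)
    (hr : r ∈ Set.Icc 0 L) (hM : 0 ≤ M) (hN : 0 ≤ N) (hx : η 0 = γ 0) (hy : θ 0 = γ L)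
    (hz : η M = θ N) (hfη : ∀ t ∈ Set.Icc 0 M, 59 / 40 < rdist (γ r) (η t))
    (hfθ : ∀ t ∈ Set.Icc 0 N, 59 / 40 < rdist (γ r) (θ t)) :
    ∃ w, ∀ P : V → Prop, (∀ u v, ¬ G.Adj u v → P u → P v) → P w → InducedFamily G P := by
  have hL : 0 ≤ L := hr.1.trans hr.2
  have hr0 : 59 / 40 < r := by
    have := hfη 0 ⟨le_rfl, hM⟩
    rwa [hx, rdist_comm, hγ.rdist_eq le_rfl hr.1 hr.2, sub_zero] at this
  have hr1 : 59 / 40 < L - r := by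
    have := hfθ 0 ⟨le_rfl, hN⟩
    rwa [hy, hγ.rdist_eq hr.1 hr.2 le_rfl] at this
  have hd : rdist (γ 0) (γ L) = L := by rw [hγ.rdist_eq le_rfl hL le_rfl, sub_zero]
  have hL3 : L ≤ 3 := hd ▸ rdist_le_three hG (γ 0) (γ L)
  -- The length exceeds 59/20, so two coordinates at opposite ends add up to less than 21/20. As
  -- some coordinate at each end is at least 1/2, all nonzero ones lie between 9/20 and 11/20.
  have hbound : ∀ c d, (γ 0).coord c ≠ 0 → (γ L).coord d ≠ 0 →
      59 / 20 < (1 - (γ 0).coord c) + 2 + (1 - (γ L).coord d) := by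
    intro c d hc hd'
    have := rdist_le_two_add hG hc hd'
    linarith
  obtain ⟨a₀, ha₀⟩ := exists_half_le_coord (γ 0)
  obtain ⟨b₀, hb₀⟩ := exists_half_le_coord (γ L)
  have hab₀ := hbound a₀ b₀ (by linarith) (by linarith)
  obtain ⟨a₁, haa, ha₁⟩ := exists_adj_of_coord_lt_one (x := γ 0) (a := a₀) (by linarith)
    (by linarith)
  obtain ⟨b₁, hbb, hb₁⟩ := exists_adj_of_coord_lt_one (x := γ L) (a := b₀) (by linarith)
    (by linarith)
  have hleave := hγ.leaves_edge hG hL haa.ne (s := 1 - (γ 0).coord a₀) (by linarith) (by linarith)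
    (by ring) (by linarith)
  have hnot : (γ L).coord ∉ edgeSegment a₀ a₁ := by
    intro hmem
    have h1 := rdist_le_of_mem_edge haa (mem_edgeSegment_of_coord haa.ne ha₁) hmem
    have h2 := coord_nonneg (γ L) a₀
    have h3 := coord_le_one (γ L) a₀
    have h4 : |(γ 0).coord a₀ - (γ L).coord a₀| ≤ 1 := abs_sub_le_iff.2 ⟨by linarith, by linarith⟩
    linarith
  -- Here `a` is the end of the initial edge through which the geodesic leaves.
  obtain ⟨a, a', haa', hsum, hs, hs', hsL, hγa⟩ : ∃ a a', G.Adj a' a ∧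
      (γ 0).coord a + (γ 0).coord a' = 1 ∧ 9 / 20 < (γ 0).coord a ∧ (γ 0).coord a < 11 / 20 ∧
      1 - (γ 0).coord a ≤ L ∧ γ (1 - (γ 0).coord a) = ofVertex G a := by
    rcases hleave with ⟨h1, h2⟩ | ⟨h1, h2⟩ | h1
    · exact ⟨a₀, a₁, haa.symm, ha₁, by linarith, by linarith, h1, h2⟩
    · have h3 : 1 - (1 - (γ 0).coord a₀) = 1 - (γ 0).coord a₁ := by linarith
      rw [h3] at h1 h2
      exact ⟨a₁, a₀, haa, by linarith, by linarith, by linarith, h1, h2⟩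
    · exact absurd h1 hnot
  set s := 1 - (γ 0).coord a with hsdef
  obtain ⟨w, haw, hγw⟩ := hγ.exists_next hG (by linarith) (by linarith) hγa
  obtain ⟨b, hwb, hγb⟩ := hγ.exists_next hG (by linarith) (by linarith) hγw
  have hyb := hγ.coord_last hG (by linarith) (by linarith) (by linarith) hγb
  have hyb0 : (γ L).coord b ≠ 0 := by rw [hyb]; intro; linarith
  obtain ⟨b', hbb', hsum'⟩ : ∃ b', G.Adj b' b ∧ (γ L).coord b + (γ L).coord b' = 1 := by
    rcases eq_or_eq_of_coord_ne_zero hbb.ne hb₁ hyb0 with rfl | rfl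
    · exact ⟨b₁, hbb.symm, hb₁⟩
    · exact ⟨b₀, hbb, by linarith⟩
  have hxa' : (γ 0).coord a' = s := by linarith
  have ha0 : (γ 0).coord a ≠ 0 := by linarith
  have ha0' : (γ 0).coord a' ≠ 0 := by rw [hxa']; intro; linarith
  have hb1 : (γ L).coord b < 11 / 20 := by
    have h1 := hbound a b ha0 hyb0
    have h2 := hbound a' b ha0' hyb0
    linarith
  have hb2 : (γ L).coord b' < 11 / 20 := by
    by_cases h0 : (γ L).coord b' = 0
    · linarith
    · have h1 := hbound a b' ha0 h0
      have h2 := hbound a' b' ha0' h0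
      linarith
  refine ⟨w, fun P hP hPw => ?_⟩
  -- Both `r` and `s + 1` are close to 3/2: `r` lies between 59/40 and 61/40, and `s + 1` between
  -- 58/40 and 62/40. So the other sides stay at distance more than 56/40 > 1 from `w`.
  have hclose : rdist (γ r) (ofVertex G w) ≤ 3 / 40 := by
    rw [← hγw, hγ r hr (s + 1) ⟨by linarith, by linarith⟩]
    exact abs_sub_le_iff.2 ⟨by linarith, by linarith⟩
  refine inducedFamily_of_isometricOn (a := a) (a' := a') (b := b) (b' := b') (w := w) hG haa'
    hbb' haw hwb.symm ?_ hP hPw (γ := η) (η := θ) (s := s) (t := (γ L).coord b') hη hθ hM hN (by linarith)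
    (by linarith) (by linarith) (by linarith) (by rw [hx]; linarith) (by rw [hx, hxa'])
    (by rw [hy]; linarith) (by rw [hy]) hz ?_ ?_
  · intro p q hp hq
    have hp' : 9 / 20 < (γ 0).coord p := by rcases hp with rfl | rfl <;> linarith
    have hq' : 9 / 20 < (γ L).coord q := by rcases hq with rfl | rfl <;> linarith
    constructor
    · rintro rfl
      have := rdist_le_of_common (x := γ 0) (y := γ L) (a := p) (by linarith) (by linarith)
      linarith
    · intro hadj
      have := rdist_le_of_adj (x := γ 0) (y := γ L) (by linarith) (by linarith) hadj
      linarith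
  · intro t ht
    have h1 := hfη t ht
    have h2 := rdist_triangle hG (γ r) (ofVertex G w) (η t)
    rw [rdist_comm (ofVertex G w)] at h2
    linarith
  · intro t ht
    have h1 := hfθ t ht
    have h2 := rdist_triangle hG (γ r) (ofVertex G w) (θ t)
    rw [rdist_comm (ofVertex G w)] at h2
    linarith

lemma IsGeodesicSegment.exists_isometricOn {x y : MetricGraph G} {S : Set (MetricGraph G)}
    (h : IsGeodesicSegment x y S) : ∃ (L : ℝ) (γ : ℝ → MetricGraph G), 0 ≤ L ∧ γ 0 = x ∧ γ L = y ∧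
      IsometricOn γ L ∧ S = γ '' Set.Icc 0 L := by
  obtain ⟨L, γ, hL, h0, h1, hγ, hS⟩ := h
  refine ⟨L, γ, hL, h0, h1, fun s hs t ht => ?_, hS⟩
  rw [rdist, hγ s hs t ht, ENNReal.toReal_ofReal (abs_nonneg _)]

/-- The vertex `w` is found before `P` is chosen, so that `P` can be taken to be the factor
containing `w`. -/
lemma exists_center_of_lt (hG : ∀ a b, G.edist a b ≤ 2)
    (h : ENNReal.ofReal (59 / 40) < graphHyperbolicityConstant G) :
    ∃ w, ∀ P : V → Prop, (∀ u v, ¬ G.Adj u v → P u → P v) → P w → InducedFamily G P := by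
  obtain ⟨T, hT⟩ := lt_iSup_iff.1 h
  have hthin : ¬ T.IsThin (ENNReal.ofReal (59 / 40)) := fun h' => (sInf_le h').not_gt hT
  simp only [GeodesicTriangle.IsThin, not_forall, not_le] at hthin
  obtain ⟨i, p, hp, hlt⟩ := hthin
  have hfar : ∀ j, j ≠ i → ∀ q ∈ T.side j, 59 / 40 < rdist p q := by
    intro j hj q hq
    have := hlt.trans_le (Metric.infEDist_le_edist_of_mem (Set.mem_iUnion₂.2 ⟨j, hj, hq⟩))
    rw [edist_eq_ofReal hG] at this
    exact (ENNReal.ofReal_lt_ofReal_iff_of_nonneg (by norm_num)).1 this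
  obtain ⟨L, γ, hL, h0, h1, hγ, hS⟩ := (T.geodesic i).exists_isometricOn
  obtain ⟨N, θ, hN, h0', h1', hθ, hS'⟩ := (T.geodesic (i + 1)).exists_isometricOn
  obtain ⟨M, η, hM, h0'', h1'', hη, hS''⟩ := (T.geodesic (i + 2)).symm.exists_isometricOn
  rw [hS] at hp
  obtain ⟨r, hr, rfl⟩ := hp
  refine exists_center_of_isometricOn hG hγ hη hθ hr hM hN ?_ ?_ ?_ ?_ ?_
  · rw [h0, h0'', show i + 2 + 1 = i by omega]
  · rw [h1, h0']
  · rw [h1', h1'', show i + 1 + 1 = i + 2 by omega]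
  · intro t ht
    exact hfar (i + 2) (by omega) _ (hS'' ▸ Set.mem_image_of_mem η ht)
  · intro t ht
    exact hfar (i + 1) (by omega) _ (hS' ▸ Set.mem_image_of_mem θ ht)

end GraphHyp

/-! ### The characterization of joins with constant 3/2. -/

theorem mainTheorem5 {V₁ : Type u} {V₂ : Type v} [Nonempty V₁] [Nonempty V₂]
    (G₁ : SimpleGraph V₁) (G₂ : SimpleGraph V₂) :
    GraphHyp.graphHyperbolicityConstant (GraphHyp.graphJoin G₁ G₂) = 3 / 2 ↔
      G₁ ∈ GraphHyp.familyF V₁ ∨ G₂ ∈ GraphHyp.familyF V₂ := by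
  have hG := GraphHyp.edist_graphJoin_le G₁ G₂
  rw [← GraphHyp.inducedFamily_left_iff G₁ G₂, ← GraphHyp.inducedFamily_right_iff G₁ G₂]
  constructor
  · intro h
    have hlt : ENNReal.ofReal (59 / 40) <
        GraphHyp.graphHyperbolicityConstant (GraphHyp.graphJoin G₁ G₂) := by
      rw [h, show (3 / 2 : ℝ≥0∞) = ENNReal.ofReal (3 / 2) by
        rw [ENNReal.ofReal_div_of_pos (by norm_num)]; norm_num]
      exact (ENNReal.ofReal_lt_ofReal_iff (by norm_num)).2 (by norm_num)
    obtain ⟨w, hw⟩ := GraphHyp.exists_center_of_lt hG hlt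
    -- The factor containing `w` is closed under non-adjacency, because the join has all edges
    -- between its factors.
    rcases w with w | w
    · refine Or.inl (hw _ ?_ rfl)
      rintro (u | u) (v | v) huv hu
      · rfl
      · exact absurd (GraphHyp.graphJoin_adj_inl_inr G₁ G₂) huv
      · simp at hu
      · simp at hu
    · refine Or.inr (hw _ ?_ rfl)
      rintro (u | u) (v | v) huv hu
      · simp at hu
      · simp at hu
      · exact absurd (GraphHyp.graphJoin_adj_inl_inr G₁ G₂).symm huv
      · rfl
  · intro h
    refine le_antisymm (GraphHyp.MetricGraph.hyperbolicityConstant_le hG) ?_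
    exact h.elim (fun h => h.three_halves_le hG) (fun h => h.three_halves_le hG)
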